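/- \textbf{Notation.} For a distribution function (df) $F$ on $\mathbb{R}$ let $r(F)=\sup\{x: F(x)<1\}\in(-\infty,\infty]$ and $F^{-}(y)=\inf\{x: F(x)\ge y\}$. Limits as $x\to r(F)$ are taken from below. For norming constants $b_n\in\mathbb{R}$ and $a_n$ with $a_n>0$ for all large $n$, say that $F$ \emph{is attracted to $G$ with norming constants $a_n,b_n$} if $\lim_{n\to\infty}F^n(a_nx+b_n)=G(x)$ at every continuity point $x$ of $G$; write $F\in D_l(G)$ if this holds for some $a_n>0$, $b_n\in\mathbb{R}$. Let $\Phi_\alpha(x)=\exp(-x^{-\alpha})$ for $x>0$ and $0$ otherwise; $\Psi_\alpha(x)=\exp(-|x|^{\alpha})$ for $x<0$ and $1$ otherwise ($\alpha>0$); $\Lambda(x)=\exp(-e^{-x})$. Two dfs $F,G$ are \emph{tail equivalent} if $r(F)=r(G)$ and $(1-F(x))/(1-G(x))$ tends to a limit in $(0,\infty)$ as $x\to r(F)$. A function $v$ that is positive on $(-\infty,r(F))$ is called an \emph{auxiliary function} of $F$ if $\lim_{t\uparrow r(F)}\frac{1-F(t+v(t)x)}{1-F(t)}=e^{-x}$ for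 every $x\ge 0$. \textbf{Theorem.} Let $F$ be an absolutely continuous df with probability density function (pdf) $f$, let $k\ge1$ be an integer, and let $$F_k(x)=F(x)\sum_{i=0}^{k-1}\frac{(-\ln F(x))^i}{i!}\quad\text{if } F(x)>0,\qquad F_k(x)=0\quad\text{if } F(x)=0 .$$ Let $H_k(x)=1-(1-F(x))^k$. Then: (a) $F_k$ is a df with $r(F_k)=r(F)$; it has the pdf $f_k(x)=\frac{f(x)}{(k-1)!}(-\ln F(x))^{k-1}$ on $\{F>0\}$ (and $f_k=0$ elsewhere); and $\lim_{x\to r(F)}\frac{1-F_k(x)}{(1-F(x))^k}=\frac1{k!}$, so that $F_k$ is tail equivalent to $H_k$. (b) If $F\in D_l(\Phi_\alpha)$ for some $\alpha>0$, then $r(F_k)=r(F)=\infty$ and $F_k\in D_l(\Phi_{k\alpha})$; the norming constants $a_n=F^{-}\bigl(1-(k!/n)^{1/k}\bigr)$, $b_n=0$ may be used. (c) If $F\in D_l(\Psi_\alpha)$ for some $\alpha>0$, then $r(F_k)=r(F)<\infty$ and $F_k\in D_l(\Psi_{k\alpha})$; the norming constants $a_n=r(F)-F^{-}\bigl(1-(k!/n)^{1/k}\bigr)$,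 $b_n=r(F)$ may be used. (d) If $F\in D_l(\Lambda)$, then $r(F_k)=r(F)$ and $F_k\in D_l(\Lambda)$; for every auxiliary function $v$ of $F$, the norming constants $b_n=F_k^{-}(1-1/n)$, $a_n=v(b_n)/k$ may be used. Moreover $\int_t^{\infty}(1-F(s))\,ds<\infty$ for every $t\in\mathbb{R}$, and the mean residual life $v(t)=\frac{\int_t^{r(F)}(1-F(s))\,ds}{1-F(t)}$, $t<r(F)$, is an auxiliary function of $F$. (The constants in (b), (c) and (d) are considered for $n$ so large that the quantiles are taken at levels in $(0,1)$.) -/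

import Mathlib

open Filter Topology MeasureTheory Set

namespace UpperOrder

/-- `F` is a distribution function on the real line. -/
structure IsDF (F : ℝ → ℝ) : Prop where
  mono : Monotone F
  rightCts : ∀ x, ContinuousWithinAt F (Ici x) x
  tendsto_atBot : Tendsto F atBot (𝓝 0)
  tendsto_atTop : Tendsto F atTop (𝓝 1)

/-- `f` is a probability density function of `F`; a distribution function is absolutely continuous
exactly if it has one. -/
structure IsPdf (F f : ℝ → ℝ) : Prop where
  nonneg : ∀ x, 0 ≤ f x
  integrable : Integrable f volume
  eq_integral : ∀ x, F x = ∫ t in Iic x, f t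

/-- The right extremity `r(F) = sup {x : F x < 1}`, possibly infinite. -/
noncomputable def rightEnd (F : ℝ → ℝ) : EReal :=
  sSup (Real.toEReal '' {x : ℝ | F x < 1})

/-- The filter of real `x` tending to `r(F)` from below (it is `atTop` if `r(F) = ∞`). -/
noncomputable def toRightEnd (F : ℝ → ℝ) : Filter ℝ :=
  comap Real.toEReal (𝓝[<] rightEnd F)

/-- The quantile function `F⁻(y) = inf {x : F x ≥ y}`; a genuine infimum for a distribution
function and `0 < y < 1`. -/
noncomputable def quantile (F : ℝ → ℝ) (y : ℝ) : ℝ :=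
  sInf {x : ℝ | y ≤ F x}

/-- `F_k(x) = F(x) ∑_{i<k} (-ln F(x))^i / i!`; the value is `0` where `F x = 0`. -/
noncomputable def upperDF (F : ℝ → ℝ) (k : ℕ) (x : ℝ) : ℝ :=
  F x * ∑ i ∈ Finset.range k, (-Real.log (F x)) ^ i / (i.factorial : ℝ)

/-- `f_k(x) = f(x) (-ln F(x))^(k-1) / (k-1)!` on `{F > 0}`, and `0` elsewhere. -/
noncomputable def upperPdf (F f : ℝ → ℝ) (k : ℕ) (x : ℝ) : ℝ :=
  open Classical in
  if 0 < F x then f x / ((k - 1).factorial : ℝ) * (-Real.log (F x)) ^ (k - 1) else 0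

/-- `H_k = 1 - (1 - F)^k`. -/
noncomputable def powerTailDF (F : ℝ → ℝ) (k : ℕ) (x : ℝ) : ℝ :=
  1 - (1 - F x) ^ k

/-- Tail equivalence: equal right extremities, and the ratio of the tails has a limit in
`(0, ∞)` there. -/
def TailEquivalent (F G : ℝ → ℝ) : Prop :=
  rightEnd F = rightEnd G ∧
    ∃ c : ℝ, 0 < c ∧ Tendsto (fun x => (1 - F x) / (1 - G x)) (toRightEnd F) (𝓝 c)

/-- `F^n(a_n x + b_n) → G(x)` at all continuity points `x` of `G`, where the norming constants
satisfy `a_n > 0` (for all large `n`, which is all that a limit in `n` can see). -/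
def MaxConverges (F G : ℝ → ℝ) (a b : ℕ → ℝ) : Prop :=
  (∀ᶠ n in atTop, 0 < a n) ∧
    ∀ x, ContinuousAt G x → Tendsto (fun n => F (a n * x + b n) ^ n) atTop (𝓝 (G x))

/-- `F` belongs to the max domain of attraction of `G` under linear normalization. -/
def InMaxDomain (F G : ℝ → ℝ) : Prop :=
  ∃ a b : ℕ → ℝ, (∀ n, 0 < a n) ∧ MaxConverges F G a b

/-- The Fréchet law `Φ_α`. -/
noncomputable def frechet (α x : ℝ) : ℝ :=
  open Classical in if 0 < x then Real.exp (-(x ^ (-α))) else 0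

/-- The Weibull law `Ψ_α`. -/
noncomputable def weibull (α x : ℝ) : ℝ :=
  open Classical in if x < 0 then Real.exp (-(|x| ^ α)) else 1

/-- The Gumbel law `Λ`. -/
noncomputable def gumbel (x : ℝ) : ℝ :=
  Real.exp (-Real.exp (-x))

/-- `v` is an auxiliary function of `F`: it is positive to the left of `r(F)`, and
`(1 - F(t + v(t) x)) / (1 - F(t)) → e^{-x}` as `t ↑ r(F)`, for every `x ≥ 0`. -/
def IsAuxiliary (F v : ℝ → ℝ) : Prop :=
  (∀ t : ℝ, (t : EReal) < rightEnd F → 0 < v t) ∧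
    ∀ x : ℝ, 0 ≤ x →
      Tendsto (fun t => (1 - F (t + v t * x)) / (1 - F t)) (toRightEnd F) (𝓝 (Real.exp (-x)))

/-- The mean residual life `(∫_t^{r(F)} (1 - F(s)) ds) / (1 - F(t))`; the integrand vanishes
beyond `r(F)`. -/
noncomputable def meanResidualLife (F : ℝ → ℝ) (t : ℝ) : ℝ :=
  (∫ s in Ioi t, (1 - F s)) / (1 - F t)

end UpperOrder

/-!
Everything is read off from the tail `1 - F` near the right extremity.

Since `F` has a density it is continuous, so a variable tends to `r(F)` from below exactly if the
tail tends to `0` through positive values (`toRightEnd_eq`). Moreover `F_k = u_k ∘ F` for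
`u_k(p) = p ∑_{i<k} (-ln p)^i / i!`, whose derivative is `(-ln p)^(k-1) / (k-1)!`. As `F` is
uniformly distributed under its own law (`map_law_eq_uniform`), integrating `u_k'` over `[0, F x]`
gives the density of `F_k`; and the remainder of the exponential series gives
`1 - u_k(1 - u) ~ u^k / k!` (`tendsto_one_sub_upperFun_div_pow`). Hence if the tails of `F` at points
`p_n` are asymptotically `ρ u_n` with `n u_n^k → k!`, then `F_k(p_n)^n → exp(-ρ^k)`. It remains to
know ratios of tails of `F`, that is, to derive the classical descriptions of the three domains of
attraction.

The hypothesis says that the antitone functions `x ↦ n (1 - F(a_n x + b_n))` converge to a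
continuous, strictly decreasing limit `τ`. Such convergence is locally uniform
(`tendsto_apply_of_antitone`) and can be inverted (`tendsto_of_tendsto_apply_of_antitone`).

* Fréchet and Weibull. Comparing `n` with `2 n` shows that `a_{2n} / a_n` tends to `2^{±1/α}` and
  `(b_{2n} - b_n) / a_n` to `0`. Along `n = 2^j` this allows `b_n` to be replaced by `0`, or by
  `r(F)`. Since `2^j (1 - F(y))` stays in `[1/2, 1]` for a suitable `j`, compactness yields regular
  variation of the tail along all `y` (`tendsto_tail_ratio_of_scaling`).
* Gumbel. The scale `v(t) = a_n` at `n = ⌊1 / (1 - F t)⌋` satisfies the relation of an auxiliary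
  function for all real `x`. Every auxiliary function is asymptotically equal to `v`, and conversely
  the relation passes to every function asymptotically equal to `v`. One step `t ↦ t + v(t)` eventually halves
  both the tail and its product with `v`, so the integral of the tail from `t` is at most
  `2 v(t) (1 - F t)`; with dominated convergence on `[t, t + M v(t)]` it follows that the mean
  residual life is asymptotically equal to `v`.
-/

namespace UpperOrder

/-! ### The function taking `F` to `F_k` -/

/-- The function `p ↦ p ∑_{i<k} (-ln p)^i / i!`, through which `F_k` depends on `F`. -/
noncomputable def upperFun (k : ℕ) (p : ℝ) : ℝ :=
  p * ∑ i ∈ Finset.range k, (-Real.log p) ^ i / (i.factorial : ℝ)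

lemma upperDF_eq (F : ℝ → ℝ) (k : ℕ) (x : ℝ) : upperDF F k x = upperFun k (F x) := rfl

lemma upperFun_zero (k : ℕ) : upperFun k 0 = 0 := by simp [upperFun]

lemma upperFun_one {k : ℕ} (hk : 1 ≤ k) : upperFun k 1 = 1 := by
  obtain ⟨m, rfl⟩ := Nat.exists_eq_add_of_le' hk
  simp [upperFun, Finset.sum_range_succ']

/-- The sum telescopes on differentiation, which is why `F_k` has the density `f_k`. -/
lemma hasDerivAt_upperFun (k : ℕ) {p : ℝ} (hp : 0 < p) :
    HasDerivAt (upperFun (k + 1)) ((-Real.log p) ^ k / (k.factorial : ℝ)) p := by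
  induction k with
  | zero =>
    have : upperFun (0 + 1) = fun p => p := by ext q; simp [upperFun]
    rw [this]; simpa using hasDerivAt_id' p
  | succ k ih =>
    have hl : HasDerivAt (fun p => -Real.log p) (-p⁻¹) p := (Real.hasDerivAt_log hp.ne').neg
    have h2 : HasDerivAt (fun q => q * ((-Real.log q) ^ (k + 1) / ((k + 1).factorial : ℝ)))
        (1 * ((-Real.log p) ^ (k + 1) / ((k + 1).factorial : ℝ)) +
          p * (((k + 1 : ℕ) : ℝ) * (-Real.log p) ^ k * (-p⁻¹) / ((k + 1).factorial : ℝ))) p :=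
      (hasDerivAt_id' p).mul ((hl.pow (k + 1)).div_const ((k + 1).factorial : ℝ))
    have h3 := ih.add h2
    have hfun : upperFun (k + 1 + 1) = upperFun (k + 1) +
        fun q => q * ((-Real.log q) ^ (k + 1) / ((k + 1).factorial : ℝ)) := by
      ext q
      simp only [upperFun, Pi.add_apply, Finset.sum_range_succ _ (k + 1), mul_add]
    rw [hfun]
    refine h3.congr_deriv ?_
    have hk : ((k + 1).factorial : ℝ) = (k + 1) * k.factorial := by
      push_cast [Nat.factorial_succ]; ring
    have hk0 : (k.factorial : ℝ) ≠ 0 := by positivity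
    have hk1 : (k + 1 : ℝ) ≠ 0 := by positivity
    rw [hk]
    push_cast
    field_simp
    ring

lemma continuousOn_upperFun (k : ℕ) : ContinuousOn (upperFun k) (Icc 0 1) := by
  have key : ∀ i : ℕ, ContinuousOn (fun p : ℝ => p * (-Real.log p) ^ i) (Icc 0 1) := by
    intro i p hp
    rcases hp.1.eq_or_lt with h | h
    · subst h
      have h1 : Tendsto (fun p : ℝ => p * (-Real.log p) ^ i) (𝓝[>] 0) (𝓝 0) := by
        have := (Real.isLittleO_pow_log_id_atTop (n := i)).tendsto_div_nhds_zero.comp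
          tendsto_inv_nhdsGT_zero
        refine this.congr' ?_
        filter_upwards [self_mem_nhdsWithin] with x hx
        simp [Real.log_inv, mul_comm]
      have h2 : ContinuousWithinAt (fun p : ℝ => p * (-Real.log p) ^ i) (Ioi 0) 0 := by
        simpa [ContinuousWithinAt] using h1
      rw [← continuousWithinAt_insert_self, Ioi_insert] at h2
      exact h2.mono fun x hx => hx.1
    · exact (continuousAt_id.mul
        ((Real.continuousAt_log h.ne').neg.pow i)).continuousWithinAt
  have : upperFun k = fun p => ∑ i ∈ Finset.range k,
      (p * (-Real.log p) ^ i) / (i.factorial : ℝ) := by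
    ext p; simp [upperFun, Finset.mul_sum, mul_div_assoc]
  rw [this]
  exact continuousOn_finsetSum _ fun i _ => (key i).div_const _

lemma strictMonoOn_upperFun {k : ℕ} (hk : 1 ≤ k) : StrictMonoOn (upperFun k) (Icc 0 1) := by
  obtain ⟨m, rfl⟩ := Nat.exists_eq_add_of_le' hk
  refine strictMonoOn_of_deriv_pos (convex_Icc 0 1) (continuousOn_upperFun _) ?_
  intro p hp
  rw [interior_Icc] at hp
  rw [(hasDerivAt_upperFun m hp.1).deriv]
  have := Real.log_neg hp.1 hp.2
  have : 0 < -Real.log p := by linarith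
  positivity

lemma upperFun_lt_one_iff {k : ℕ} (hk : 1 ≤ k) {p : ℝ} (h0 : 0 ≤ p) (h1 : p ≤ 1) :
    upperFun k p < 1 ↔ p < 1 := by
  conv_lhs => rw [← upperFun_one hk]
  exact (strictMonoOn_upperFun hk).lt_iff_lt ⟨h0, h1⟩ ⟨zero_le_one, le_rfl⟩

/-- With `L = -ln (1 - u)` the quotient is `e^{-L} (e^L - ∑_{i<k} L^i / i!) / u^k`, and the
remainder of the exponential series is asymptotic to `L^k / k!`, where `L` is asymptotic
to `u`. -/
lemma tendsto_one_sub_upperFun_div_pow (k : ℕ) :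
    Tendsto (fun u => (1 - upperFun k (1 - u)) / u ^ k) (𝓝[>] 0) (𝓝 (1 / (k.factorial : ℝ))) := by
  set L : ℝ → ℝ := fun u => -Real.log (1 - u) with hL
  have hd : HasDerivAt L 1 0 := by
    have h := (((hasDerivAt_id' (0 : ℝ)).const_sub 1).log (by simp)).neg
    exact h.congr_deriv (by simp)
  have hL0 : L 0 = 0 := by simp [hL]
  have hLu : Tendsto (fun u => L u / u) (𝓝[>] 0) (𝓝 1) := by
    have := (hasDerivAt_iff_tendsto_slope.1 hd).mono_left
      (nhdsWithin_mono (0 : ℝ) (fun x (hx : 0 < x) => hx.ne'))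
    refine this.congr fun u => ?_
    simp [slope_def_field, hL0]
  have hLt : Tendsto L (𝓝[>] 0) (𝓝 0) := by
    have := hd.continuousAt.tendsto
    rw [hL0] at this
    exact this.mono_left nhdsWithin_le_nhds
  have hexp : Tendsto (fun u => Real.exp (-L u)) (𝓝[>] 0) (𝓝 1) := by
    have h := (Real.continuous_exp.tendsto (-0)).comp hLt.neg
    simpa [Function.comp_def] using h
  have hrem : Tendsto (fun u => (Real.exp (L u) -
      ∑ i ∈ Finset.range (k + 1), L u ^ i / (i.factorial : ℝ)) / L u ^ k) (𝓝[>] 0) (𝓝 0) :=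
    (Real.exp_sub_sum_range_succ_isLittleO_pow k).tendsto_div_nhds_zero.comp hLt
  have hmain := (hexp.mul (hrem.add_const (1 / (k.factorial : ℝ)))).mul (hLu.pow k)
  simp only [one_pow, zero_add, one_mul, mul_one] at hmain
  refine hmain.congr' ?_
  filter_upwards [Ioo_mem_nhdsGT (zero_lt_one' ℝ)] with u hu
  have h1u : 0 < 1 - u := by linarith [hu.2]
  have hLpos : 0 < L u := by
    have := Real.log_neg h1u (by linarith [hu.1])
    simp only [hL]; linarith
  have he : Real.exp (L u) * (1 - u) = 1 := by
    simp only [hL]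
    rw [Real.exp_neg, Real.exp_log h1u, inv_mul_cancel₀ h1u.ne']
  have he' : Real.exp (-L u) = 1 - u := by simp only [hL, neg_neg, Real.exp_log h1u]
  have hu0 := hu.1.ne'
  rw [he', Finset.sum_range_succ, upperFun]
  change _ = (1 - (1 - u) * ∑ i ∈ Finset.range k, L u ^ i / (i.factorial : ℝ)) / u ^ k
  set S := ∑ i ∈ Finset.range k, L u ^ i / (i.factorial : ℝ)
  have hk0 : (k.factorial : ℝ) ≠ 0 := by positivity
  have hLk : L u ^ k ≠ 0 := by positivity
  have huk : u ^ k ≠ 0 := pow_ne_zero _ hu0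
  calc (1 - u) * ((Real.exp (L u) - (S + L u ^ k / (k.factorial : ℝ))) / L u ^ k +
        1 / (k.factorial : ℝ)) * (L u / u) ^ k
      = (Real.exp (L u) * (1 - u) - (1 - u) * S) / u ^ k := by
        rw [div_pow]; field_simp; ring
    _ = _ := by rw [he]

/-! ### Distribution functions, their densities and quantiles -/

lemma IsDF.nonneg {F : ℝ → ℝ} (hF : IsDF F) (x : ℝ) : 0 ≤ F x :=
  le_of_tendsto hF.tendsto_atBot ((eventually_le_atBot x).mono fun _ h => hF.mono h)

lemma IsDF.le_one {F : ℝ → ℝ} (hF : IsDF F) (x : ℝ) : F x ≤ 1 :=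
  ge_of_tendsto hF.tendsto_atTop ((eventually_ge_atTop x).mono fun _ h => hF.mono h)

lemma IsDF.antitone_tail {F : ℝ → ℝ} (hF : IsDF F) : Antitone fun x => 1 - F x :=
  fun _ _ h => sub_le_sub_left (hF.mono h) 1

lemma IsPdf.continuous {F f : ℝ → ℝ} (hf : IsPdf F f) : Continuous F := by
  have h : F = fun x => F 0 + ∫ t in (0 : ℝ)..x, f t := by
    ext x
    rw [hf.eq_integral x, hf.eq_integral 0, ← intervalIntegral.integral_Iic_sub_Iic
      hf.integrable.integrableOn hf.integrable.integrableOn]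
    ring
  rw [h]
  exact continuous_const.add
    (intervalIntegral.continuous_primitive (fun _ _ => hf.integrable.intervalIntegrable) 0)

lemma IsDF.exists_eq {F : ℝ → ℝ} (hF : IsDF F) (hc : Continuous F) {y : ℝ} (h0 : 0 < y)
    (h1 : y < 1) : ∃ x, F x = y := by
  obtain ⟨a, ha⟩ := (hF.tendsto_atBot.eventually_lt_const h0).exists
  obtain ⟨b, hb⟩ := (hF.tendsto_atTop.eventually_const_lt h1).exists
  exact mem_range_of_exists_le_of_exists_ge hc ⟨a, ha.le⟩ ⟨b, hb.le⟩

lemma IsDF.apply_quantile {F : ℝ → ℝ} (hF : IsDF F) (hc : Continuous F) {y : ℝ} (h0 : 0 < y)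
    (h1 : y < 1) : F (quantile F y) = y := by
  obtain ⟨x, hx⟩ := hF.exists_eq hc h0 h1
  obtain ⟨a, ha⟩ := (hF.tendsto_atBot.eventually_lt_const h0).exists
  have hbdd : BddBelow {x : ℝ | y ≤ F x} :=
    ⟨a, fun z (hz : y ≤ F z) => le_of_lt (hF.mono.reflect_lt (ha.trans_le hz))⟩
  have hmem : quantile F y ∈ {x : ℝ | y ≤ F x} :=
    (isClosed_le continuous_const hc).csInf_mem ⟨x, hx.ge⟩ hbdd
  refine le_antisymm ?_ hmem
  calc F (quantile F y) ≤ F x := hF.mono (csInf_le hbdd hx.ge)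
    _ = y := hx

/-- The law with density `f`. -/
noncomputable def law (f : ℝ → ℝ) : Measure ℝ :=
  volume.withDensity fun t => ENNReal.ofReal (f t)

lemma law_Iic {F f : ℝ → ℝ} (hf : IsPdf F f) (x : ℝ) : law f (Iic x) = ENNReal.ofReal (F x) := by
  rw [law, withDensity_apply _ measurableSet_Iic, hf.eq_integral x,
    ofReal_integral_eq_lintegral_ofReal hf.integrable.integrableOn (ae_of_all _ hf.nonneg)]

/-- The probability integral transform: a continuous distribution function is uniformly
distributed on `[0, 1]` under its own law. -/
lemma map_law_eq_uniform {F f : ℝ → ℝ} (hF : IsDF F) (hf : IsPdf F f) :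
    (law f).map F = volume.restrict (Icc 0 1) := by
  have hc := hf.continuous
  have huniv : law f univ = 1 := by
    have h1 := tendsto_measure_Iic_atTop (law f)
    have h2 : Tendsto (fun x => law f (Iic x)) atTop (𝓝 1) := by
      simp only [law_Iic hf]
      simpa [Function.comp_def] using (ENNReal.continuous_ofReal.tendsto 1).comp hF.tendsto_atTop
    exact tendsto_nhds_unique h1 h2
  have : IsFiniteMeasure (law f) := ⟨by rw [huniv]; exact ENNReal.one_lt_top⟩
  refine Measure.ext_of_Iic _ _ fun p => ?_
  rw [Measure.map_apply hc.measurable measurableSet_Iic, Measure.restrict_apply measurableSet_Iic]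
  rcases lt_or_ge p 0 with hp | hp
  · have h1 : F ⁻¹' Iic p = ∅ := by
      ext x; simpa using hp.trans_le (hF.nonneg x)
    have h2 : Iic p ∩ Icc 0 1 = ∅ := by
      ext x; simp only [mem_inter_iff, mem_Iic, mem_Icc, mem_empty_iff_false, iff_false]
      intro h; linarith [h.1, h.2.1]
    simp [h1, h2]
  rcases lt_or_ge p 1 with hp1 | hp1
  · have h2 : Iic p ∩ Icc 0 1 = Icc 0 p := by
      ext x; simp only [mem_inter_iff, mem_Iic, mem_Icc]
      constructor
      · rintro ⟨a, b, _⟩; exact ⟨b, a⟩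
      · rintro ⟨a, b⟩; exact ⟨b, a, b.trans hp1.le⟩
    rw [h2, Real.volume_Icc, sub_zero]
    rcases (F ⁻¹' Iic p).eq_empty_or_nonempty with he | hne
    · have : p = 0 := by
        by_contra h
        obtain ⟨x, hx⟩ := hF.exists_eq hc (hp.lt_of_ne' h) hp1
        have : x ∈ F ⁻¹' Iic p := hx.le
        simp [he] at this
      rw [he, this]; simp
    · obtain ⟨b, hb⟩ := (hF.tendsto_atTop.eventually_const_lt hp1).exists
      have hbdd : BddAbove (F ⁻¹' Iic p) :=
        ⟨b, fun z (hz : F z ≤ p) => le_of_lt (hF.mono.reflect_lt (hz.trans_lt hb))⟩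
      have hmem : sSup (F ⁻¹' Iic p) ∈ F ⁻¹' Iic p :=
        (isClosed_Iic.preimage hc).csSup_mem hne hbdd
      set s := sSup (F ⁻¹' Iic p)
      have h3 : F ⁻¹' Iic p = Iic s :=
        Subset.antisymm (fun z hz => le_csSup hbdd hz)
          (fun z hz => (hF.mono hz).trans hmem)
      have h4 : F s = p := by
        refine le_antisymm hmem ?_
        rcases hp.eq_or_lt with h | h
        · rw [← h]; exact hF.nonneg _
        · obtain ⟨x, hx⟩ := hF.exists_eq hc h hp1
          calc p = F x := hx.symm
            _ ≤ F s := hF.mono (le_csSup hbdd hx.le)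
      rw [h3, law_Iic hf, h4]
  · have h1 : F ⁻¹' Iic p = univ := by
      ext x; simpa using (hF.le_one x).trans hp1
    have h2 : Iic p ∩ Icc 0 1 = Icc 0 1 := by
      ext x; simp only [mem_inter_iff, mem_Iic, mem_Icc, and_iff_right_iff_imp]
      intro h; exact h.2.trans hp1
    rw [h1, h2, huniv]; simp

/-- The density of `F_k` is the derivative of `upperFun k` at `F`, times `f`. -/
lemma isPdf_upperDF {F f : ℝ → ℝ} (hF : IsDF F) (hf : IsPdf F f) {k : ℕ} (hk : 1 ≤ k) :
    IsPdf (upperDF F k) (upperPdf F f k) := by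
  obtain ⟨m, rfl⟩ := Nat.exists_eq_add_of_le' hk
  have hc := hf.continuous
  set g : ℝ → ℝ := fun p => if 0 < p then (-Real.log p) ^ m / (m.factorial : ℝ) else 0 with hg
  have hgm : Measurable g := by
    refine Measurable.ite measurableSet_Ioi ?_ measurable_const
    fun_prop
  have hder : ∀ p ∈ Ioo (0 : ℝ) 1, HasDerivAt (upperFun (m + 1)) (g p) p := by
    intro p hp
    simpa [hg, hp.1] using hasDerivAt_upperFun m hp.1
  have hg0 : ∀ p ≤ (1 : ℝ), 0 ≤ g p := by
    intro p hp
    simp only [hg]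
    split_ifs with h
    · have := Real.log_nonpos h.le hp
      have : 0 ≤ -Real.log p := by linarith
      positivity
    · exact le_rfl
  have hgi : IntegrableOn g (Icc 0 1) := by
    rw [integrableOn_Icc_iff_integrableOn_Ioc]
    exact intervalIntegral.integrableOn_deriv_of_nonneg (continuousOn_upperFun _) hder
      fun p hp => hg0 p hp.2.le
  have hmap := map_law_eq_uniform hF hf
  have hform : ∀ x, upperPdf F f (m + 1) x = (ENNReal.ofReal (f x)).toReal • g (F x) := by
    intro x
    rw [ENNReal.toReal_ofReal (hf.nonneg x)]
    simp only [upperPdf, hg, smul_eq_mul, Nat.add_sub_cancel]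
    split_ifs <;> ring
  have hfm : AEMeasurable (fun t => ENNReal.ofReal (f t)) volume :=
    hf.integrable.aemeasurable.ennreal_ofReal
  have hlt : ∀ᵐ t ∂(volume : Measure ℝ), ENNReal.ofReal (f t) < ⊤ :=
    ae_of_all _ fun _ => ENNReal.ofReal_lt_top
  refine ⟨fun x => ?_, ?_, fun x => ?_⟩
  · rw [hform, smul_eq_mul]
    exact mul_nonneg ENNReal.toReal_nonneg (hg0 _ (hF.le_one x))
  · have h1 : Integrable (g ∘ F) (law f) := by
      rw [← integrable_map_measure hgm.aestronglyMeasurable hc.aemeasurable, hmap]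
      exact hgi
    have h2 := (integrable_withDensity_iff_integrable_smul₀' hfm hlt).1 h1
    exact h2.congr (ae_of_all _ fun x => (hform x).symm)
  · have hset : (Iic x : Set ℝ) =ᵐ[law f] F ⁻¹' Iic (F x) := by
      have hle : law f (F ⁻¹' Iic (F x)) ≤ law f (Iic x) := by
        rw [← Measure.map_apply hc.measurable measurableSet_Iic, hmap, law_Iic hf,
          Measure.restrict_apply measurableSet_Iic]
        calc volume (Iic (F x) ∩ Icc 0 1) ≤ volume (Icc 0 (F x)) :=
              measure_mono fun y hy => ⟨hy.2.1, hy.1⟩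
          _ = ENNReal.ofReal (F x) := by simp
      exact ae_eq_of_subset_of_measure_ge (fun y hy => hF.mono hy) hle
        measurableSet_Iic.nullMeasurableSet
        (by rw [← Measure.map_apply hc.measurable measurableSet_Iic, hmap,
              Measure.restrict_apply measurableSet_Iic]
            exact ((measure_mono inter_subset_right).trans_lt (by simp)).ne)
    have hIcc : Iic (F x) ∩ Icc 0 1 = Icc 0 (F x) := by
      ext y; simp only [mem_inter_iff, mem_Iic, mem_Icc]
      constructor
      · rintro ⟨a, b, _⟩; exact ⟨b, a⟩
      · rintro ⟨a, b⟩; exact ⟨b, a, b.trans (hF.le_one x)⟩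
    have hsub : Icc 0 (F x) ⊆ Icc (0 : ℝ) 1 := Icc_subset_Icc_right (hF.le_one x)
    symm
    calc ∫ t in Iic x, upperPdf F f (m + 1) t
        = ∫ t in Iic x, (ENNReal.ofReal (f t)).toReal • g (F t) := by simp_rw [hform]
      _ = ∫ t in Iic x, g (F t) ∂law f := by
        rw [law, restrict_withDensity measurableSet_Iic,
          integral_withDensity_eq_integral_toReal_smul₀ hfm.restrict (ae_restrict_of_ae hlt)]
      _ = ∫ t in F ⁻¹' Iic (F x), g (F t) ∂law f := setIntegral_congr_set hset
      _ = ∫ p in Iic (F x), g p ∂(law f).map F :=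
        (setIntegral_map measurableSet_Iic hgm.aestronglyMeasurable hc.aemeasurable).symm
      _ = ∫ p in Icc 0 (F x), g p := by
        rw [hmap, Measure.restrict_restrict measurableSet_Iic, hIcc]
      _ = ∫ p in (0 : ℝ)..F x, g p := by
        rw [integral_Icc_eq_integral_Ioc, intervalIntegral.integral_of_le (hF.nonneg x)]
      _ = upperFun (m + 1) (F x) - upperFun (m + 1) 0 :=
        intervalIntegral.integral_eq_sub_of_hasDerivAt_of_le (hF.nonneg x)
          ((continuousOn_upperFun _).mono hsub)
          (fun p hp => hder p ⟨hp.1, hp.2.trans_le (hF.le_one x)⟩)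
          ((intervalIntegrable_iff_integrableOn_Icc_of_le (hF.nonneg x)).2 (hgi.mono_set hsub))
      _ = upperDF F (m + 1) x := by rw [upperFun_zero, sub_zero, upperDF_eq]

lemma isDF_upperDF {F : ℝ → ℝ} (hF : IsDF F) (hc : Continuous F) {k : ℕ} (hk : 1 ≤ k) :
    IsDF (upperDF F k) := by
  have hcont : Continuous (upperDF F k) :=
    (continuousOn_upperFun k).comp_continuous hc fun x => ⟨hF.nonneg x, hF.le_one x⟩
  have hlim : ∀ {l : Filter ℝ} {p : ℝ}, p ∈ Icc (0 : ℝ) 1 → Tendsto F l (𝓝 p) →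
      Tendsto (upperDF F k) l (𝓝 (upperFun k p)) := fun {l p} hp h =>
    ((continuousOn_upperFun k) p hp).tendsto.comp
      (tendsto_nhdsWithin_iff.2 ⟨h, .of_forall fun x => ⟨hF.nonneg x, hF.le_one x⟩⟩)
  refine ⟨fun x y h => ?_, fun x => hcont.continuousWithinAt, ?_, ?_⟩
  · exact (strictMonoOn_upperFun hk).monotoneOn ⟨hF.nonneg x, hF.le_one x⟩
      ⟨hF.nonneg y, hF.le_one y⟩ (hF.mono h)
  · simpa [upperFun_zero] using hlim ⟨le_rfl, zero_le_one⟩ hF.tendsto_atBot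
  · simpa [upperFun_one hk] using hlim ⟨zero_le_one, le_rfl⟩ hF.tendsto_atTop

lemma rightEnd_congr {F G : ℝ → ℝ} (h : ∀ x, F x < 1 ↔ G x < 1) : rightEnd F = rightEnd G := by
  simp only [rightEnd, h]

lemma rightEnd_upperDF {F : ℝ → ℝ} (hF : IsDF F) {k : ℕ} (hk : 1 ≤ k) :
    rightEnd (upperDF F k) = rightEnd F :=
  rightEnd_congr fun x => upperFun_lt_one_iff hk (hF.nonneg x) (hF.le_one x)

lemma rightEnd_powerTailDF {F : ℝ → ℝ} (hF : IsDF F) {k : ℕ} (hk : 1 ≤ k) :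
    rightEnd (powerTailDF F k) = rightEnd F := by
  refine rightEnd_congr fun x => ?_
  have h0 : 0 ≤ 1 - F x := by linarith [hF.le_one x]
  rw [powerTailDF, sub_lt_self_iff]
  constructor
  · intro h
    by_contra! h1
    have : 1 - F x = 0 := by linarith
    rw [this, zero_pow (by lia)] at h
    exact h.false
  · intro h
    exact pow_pos (by linarith) k

lemma lt_rightEnd_iff {F : ℝ → ℝ} (hF : IsDF F) (hc : Continuous F) (x : ℝ) :
    (x : EReal) < rightEnd F ↔ F x < 1 := by
  constructor
  · intro h
    obtain ⟨_, ⟨y, hy, rfl⟩, hxy⟩ := lt_sSup_iff.1 h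
    exact (hF.mono (EReal.coe_lt_coe_iff.1 hxy).le).trans_lt hy
  · intro h
    -- by continuity `F < 1` also a little to the right of `x`
    obtain ⟨y, hy, hxy⟩ := ((hc.tendsto x).eventually_lt_const h |>.filter_mono
      nhdsWithin_le_nhds |>.and (self_mem_nhdsWithin (s := Ioi x))).exists
    exact (EReal.coe_lt_coe_iff.2 hxy).trans_le (le_sSup ⟨y, hy, rfl⟩)

/-- For a continuous distribution function, a real variable tends to the right extremity from
below exactly if the tail tends to `0` through positive values. -/
lemma toRightEnd_eq {F : ℝ → ℝ} (hF : IsDF F) (hc : Continuous F) :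
    toRightEnd F = comap (fun x => 1 - F x) (𝓝[>] 0) := by
  have hbot : (⊥ : EReal) < rightEnd F := by
    obtain ⟨x, hx⟩ := (hF.tendsto_atBot.eventually_lt_const zero_lt_one).exists
    exact (EReal.bot_lt_coe x).trans ((lt_rightEnd_iff hF hc x).2 hx)
  have h1 := (nhdsLT_basis_of_exists_lt ⟨⊥, hbot⟩).comap Real.toEReal
  have h2 := (nhdsGT_basis (0 : ℝ)).comap (fun x => 1 - F x)
  refine le_antisymm (h1.le_basis_iff h2 |>.2 fun ε hε => ?_) (h2.le_basis_iff h1 |>.2 fun s hs => ?_)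
  · obtain ⟨x, hx⟩ := hF.exists_eq hc (y := 1 - min (ε / 2) (1 / 2))
      (by linarith [min_le_right (ε / 2) (1 / 2)])
      (by have : 0 < min (ε / 2) (1 / 2) := by positivity
          linarith)
    have hm : 0 < min (ε / 2) (1 / 2) := by positivity
    refine ⟨x, (lt_rightEnd_iff hF hc x).2 (by linarith), fun y hy => ?_⟩
    have hy1 : F y < 1 := (lt_rightEnd_iff hF hc y).1 hy.2
    have hy2 : F x ≤ F y := hF.mono (EReal.coe_lt_coe_iff.1 hy.1).le
    refine ⟨by linarith, ?_⟩
    change 1 - F y < ε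
    linarith [min_le_left (ε / 2) (1 / 2)]
  · obtain ⟨_, ⟨y, hy, rfl⟩, hsy⟩ := lt_sSup_iff.1 hs
    refine ⟨1 - F y, sub_pos.2 hy, fun z hz => ?_⟩
    have hz1 : 0 < 1 - F z := hz.1
    have hz2 : 1 - F z < 1 - F y := hz.2
    have hyz : y < z := hF.mono.reflect_lt (by linarith)
    exact ⟨hsy.trans (EReal.coe_lt_coe_iff.2 hyz), (lt_rightEnd_iff hF hc z).2 (by linarith)⟩

lemma tendsto_toRightEnd_iff {F : ℝ → ℝ} (hF : IsDF F) (hc : Continuous F) {ι : Type*}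
    {l : Filter ι} {y : ι → ℝ} :
    Tendsto y l (toRightEnd F) ↔ Tendsto (fun i => 1 - F (y i)) l (𝓝[>] 0) := by
  rw [toRightEnd_eq hF hc, tendsto_comap_iff]; rfl

lemma tendsto_tail_toRightEnd {F : ℝ → ℝ} (hF : IsDF F) (hc : Continuous F) :
    Tendsto (fun t => 1 - F t) (toRightEnd F) (𝓝[>] 0) :=
  (tendsto_toRightEnd_iff hF hc).1 tendsto_id

lemma tendsto_tail_upperDF_ratio {F : ℝ → ℝ} (hF : IsDF F) (hc : Continuous F) (k : ℕ) :
    Tendsto (fun x => (1 - upperDF F k x) / (1 - F x) ^ k) (toRightEnd F)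
      (𝓝 (1 / (k.factorial : ℝ))) := by
  have := (tendsto_one_sub_upperFun_div_pow k).comp (tendsto_tail_toRightEnd hF hc)
  simpa [Function.comp_def, upperDF_eq] using this

lemma tailEquivalent_upperDF {F : ℝ → ℝ} (hF : IsDF F) (hc : Continuous F) {k : ℕ} (hk : 1 ≤ k) :
    TailEquivalent (upperDF F k) (powerTailDF F k) := by
  refine ⟨(rightEnd_upperDF hF hk).trans (rightEnd_powerTailDF hF hk).symm,
    1 / (k.factorial : ℝ), by positivity, ?_⟩
  rw [toRightEnd, rightEnd_upperDF hF hk, ← toRightEnd]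
  simpa [powerTailDF] using tendsto_tail_upperDF_ratio hF hc k

/-! ### Powers of a distribution function and its tail -/

lemma tendsto_pow_of_tendsto_mul_one_sub {p : ℕ → ℝ} {s : ℝ}
    (h : Tendsto (fun n : ℕ => (n : ℝ) * (1 - p n)) atTop (𝓝 s)) :
    Tendsto (fun n => p n ^ n) atTop (𝓝 (Real.exp (-s))) := by
  have h' : Tendsto (fun n : ℕ => (n : ℝ) * (-(1 - p n))) atTop (𝓝 (-s)) := by
    simpa only [mul_neg] using h.neg
  simpa using Real.tendsto_one_add_pow_exp_of_tendsto h'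

/-- Squeeze `n (1 - p)` between `-n p ln p` and `-n ln p`. -/
lemma tendsto_mul_one_sub_of_tendsto_pow {p : ℕ → ℝ} {s : ℝ} (hp0 : ∀ n, 0 ≤ p n)
    (h : Tendsto (fun n => p n ^ n) atTop (𝓝 (Real.exp (-s)))) :
    Tendsto (fun n : ℕ => (n : ℝ) * (1 - p n)) atTop (𝓝 s) := by
  have hpos : ∀ᶠ n in atTop, 0 < p n := by
    filter_upwards [h.eventually_const_lt (Real.exp_pos _), eventually_gt_atTop 0] with n hn hn0
    refine (hp0 n).lt_of_ne' fun h0 => ?_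
    rw [h0, zero_pow hn0.ne'] at hn
    exact hn.false
  have hlog : Tendsto (fun n : ℕ => (n : ℝ) * -Real.log (p n)) atTop (𝓝 s) := by
    have := ((Real.continuousAt_log (Real.exp_pos (-s)).ne').tendsto.comp h).neg
    rw [Real.log_exp, neg_neg] at this
    refine this.congr fun n => ?_
    simp [Real.log_pow]
  have hlog0 : Tendsto (fun n => Real.log (p n)) atTop (𝓝 0) := by
    have := (hlog.mul tendsto_inv_atTop_nhds_zero_nat).neg
    rw [mul_zero, neg_zero] at this
    refine this.congr' ?_
    filter_upwards [eventually_gt_atTop 0] with n hn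
    have : (n : ℝ) ≠ 0 := by positivity
    field_simp
  have hp1 : Tendsto p atTop (𝓝 1) := by
    have := (Real.continuous_exp.tendsto 0).comp hlog0
    rw [Real.exp_zero] at this
    refine this.congr' ?_
    filter_upwards [hpos] with n hn using Real.exp_log hn
  have hlow := hp1.mul hlog
  rw [one_mul] at hlow
  refine tendsto_of_tendsto_of_tendsto_of_le_of_le' hlow hlog ?_ ?_
  · filter_upwards [hpos] with n hn
    have h1 := Real.one_sub_inv_le_log_of_pos hn
    have h2 : p n * -Real.log (p n) ≤ 1 - p n := by
      have := mul_le_mul_of_nonneg_left h1 hn.le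
      rw [mul_sub, mul_inv_cancel₀ hn.ne'] at this
      linarith
    calc p n * (n * -Real.log (p n)) = n * (p n * -Real.log (p n)) := by ring
      _ ≤ n * (1 - p n) := by gcongr
  · filter_upwards [hpos] with n hn
    have := Real.log_le_sub_one_of_pos hn
    gcongr
    linarith

lemma MaxConverges.inMaxDomain {F G : ℝ → ℝ} {a b : ℕ → ℝ} (h : MaxConverges F G a b) :
    InMaxDomain F G := by
  have hev : ∀ᶠ n in atTop, (if 0 < a n then a n else 1) = a n := by
    filter_upwards [h.1] with n hn using if_pos hn
  refine ⟨fun n => if 0 < a n then a n else 1, b, fun n => ?_, ?_, fun x hx => ?_⟩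
  · dsimp only
    split_ifs with h0
    · exact h0
    · exact one_pos
  · filter_upwards [hev, h.1] with n h1 h2
    rwa [h1]
  · refine (h.2 x hx).congr' ?_
    filter_upwards [hev] with n hn
    rw [hn]

/-- If the tails of `F` at `p n` are asymptotically `ρ u n`, where `n (u n)^k → k!`, then those of
`F_k` are asymptotically `ρ^k / n`. -/
lemma tendsto_mul_tail_upperDF {F : ℝ → ℝ} (hF : IsDF F) (hc : Continuous F) {k : ℕ}
    {p u : ℕ → ℝ} {ρ : ℝ} (hρ : 0 < ρ) (hu : Tendsto u atTop (𝓝[>] 0))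
    (huk : Tendsto (fun n : ℕ => (n : ℝ) * u n ^ k) atTop (𝓝 (k.factorial : ℝ)))
    (hp : Tendsto (fun n => (1 - F (p n)) / u n) atTop (𝓝 ρ)) :
    Tendsto (fun n : ℕ => (n : ℝ) * (1 - upperDF F k (p n))) atTop (𝓝 (ρ ^ k)) := by
  have hupos : ∀ᶠ n in atTop, 0 < u n := hu.eventually self_mem_nhdsWithin
  have hpr : Tendsto p atTop (toRightEnd F) := by
    rw [tendsto_toRightEnd_iff hF hc, tendsto_nhdsWithin_iff]
    constructor
    · have := hp.mul (tendsto_nhds_of_tendsto_nhdsWithin hu)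
      rw [mul_zero] at this
      refine this.congr' ?_
      filter_upwards [hupos] with n hn
      exact div_mul_cancel₀ _ hn.ne'
    · filter_upwards [hupos, hp.eventually_const_lt hρ] with n hn h
      exact (div_pos_iff_of_pos_right hn).1 h
  have h1 := (tendsto_tail_upperDF_ratio hF hc k).comp hpr
  have h2 := (h1.mul huk).mul (hp.pow k)
  rw [one_div_mul_cancel (by positivity), one_mul] at h2
  refine h2.congr' ?_
  filter_upwards [hupos, (tendsto_toRightEnd_iff hF hc).1 hpr |>.eventually self_mem_nhdsWithin]
    with n hn (hT : 0 < 1 - F (p n))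
  simp only [Function.comp_apply, div_pow]
  have := hT.ne'
  have := hn.ne'
  field_simp

/-! ### Limits of antitone functions -/

/-- A pointwise limit of antitone functions on an open set is locally uniform near a point of
continuity. -/
lemma tendsto_apply_of_antitone {ι : Type*} {l : Filter ι} {φ : ι → ℝ → ℝ} {τ : ℝ → ℝ} {S : Set ℝ}
    (hS : IsOpen S) (hφ : ∀ i, Antitone (φ i)) (hlim : ∀ x ∈ S, Tendsto (fun i => φ i x) l (𝓝 (τ x)))
    {z : ℝ} (hz : z ∈ S) (hτ : ContinuousAt τ z) {y : ι → ℝ} (hy : Tendsto y l (𝓝 z)) :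
    Tendsto (fun i => φ i (y i)) l (𝓝 (τ z)) := by
  have hSz := hS.mem_nhds hz
  refine tendsto_order.2 ⟨fun c hc => ?_, fun c hc => ?_⟩
  · obtain ⟨x, ⟨hx1, hx2⟩, hx3⟩ := ((hτ.tendsto.eventually_const_lt hc).and hSz
      |>.filter_mono (nhdsWithin_le_nhds (s := Ioi z)) |>.and self_mem_nhdsWithin).exists
    filter_upwards [hy.eventually_lt_const hx3, (hlim x hx2).eventually_const_lt hx1] with i h1 h2
    exact h2.trans_le (hφ i h1.le)
  · obtain ⟨x, ⟨hx1, hx2⟩, hx3⟩ := ((hτ.tendsto.eventually_lt_const hc).and hSz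
      |>.filter_mono (nhdsWithin_le_nhds (s := Iio z)) |>.and self_mem_nhdsWithin).exists
    filter_upwards [hy.eventually_const_lt hx3, (hlim x hx2).eventually_lt_const hx1] with i h1 h2
    exact (hφ i h1.le).trans_lt h2

/-- Inverses of antitone functions converge where the limit is strictly antitone; this replaces the
convergence of types theorem. -/
lemma tendsto_of_tendsto_apply_of_antitone {ι : Type*} {l : Filter ι} {φ : ι → ℝ → ℝ} {τ : ℝ → ℝ}
    {S : Set ℝ} (hS : IsOpen S) (hφ : ∀ i, Antitone (φ i))
    (hlim : ∀ x ∈ S, Tendsto (fun i => φ i x) l (𝓝 (τ x))) (hτ : StrictAntiOn τ S)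
    {z : ℝ} (hz : z ∈ S) {y : ι → ℝ} (hy : Tendsto (fun i => φ i (y i)) l (𝓝 (τ z))) :
    Tendsto y l (𝓝 z) := by
  have hSz := hS.mem_nhds hz
  refine tendsto_order.2 ⟨fun c hc => ?_, fun c hc => ?_⟩
  · obtain ⟨x, ⟨hx1, hx2⟩, hx3⟩ := ((lt_mem_nhds hc).and hSz
      |>.filter_mono (nhdsWithin_le_nhds (s := Iio z)) |>.and self_mem_nhdsWithin).exists
    filter_upwards [hy.eventually_lt (hlim x hx2) (hτ hx2 hz hx3)] with i h
    exact hx1.trans ((hφ i).reflect_lt h)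
  · obtain ⟨x, ⟨hx1, hx2⟩, hx3⟩ := ((gt_mem_nhds hc).and hSz
      |>.filter_mono (nhdsWithin_le_nhds (s := Ioi z)) |>.and self_mem_nhdsWithin).exists
    filter_upwards [(hlim x hx2).eventually_lt hy (hτ hz hx2 hx3)] with i h
    exact ((hφ i).reflect_lt h).trans hx1

/-! ### Regular variation of the tail in the Fréchet and Weibull cases -/

/-- A contracting affine recursion with vanishing inhomogeneity tends to `0`. -/
lemma tendsto_zero_of_recursion {q ρ ε : ℕ → ℝ} {r : ℝ} (hr0 : 0 ≤ r) (hr1 : r < 1)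
    (hρ : Tendsto ρ atTop (𝓝 r)) (hε : Tendsto ε atTop (𝓝 0))
    (hq : ∀ j, q (j + 1) = ρ j * q j + ε j) : Tendsto q atTop (𝓝 0) := by
  obtain ⟨R, hrR, hR1⟩ := exists_between hr1
  have hR0 : 0 ≤ R := hr0.trans hrR.le
  have hρ' : ∀ᶠ j in atTop, |ρ j| < R := by
    have := hρ.abs
    rw [abs_of_nonneg hr0] at this
    exact this.eventually_lt_const hrR
  rw [Metric.tendsto_atTop']
  intro δ hδ
  have hε' : ∀ᶠ j in atTop, |ε j| < δ / 2 * (1 - R) := by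
    have := hε.abs
    rw [abs_zero] at this
    exact this.eventually_lt_const (mul_pos (half_pos hδ) (by linarith))
  obtain ⟨N, hN⟩ := eventually_atTop.1 (hρ'.and hε')
  have hstep : ∀ i, |q (N + i)| - δ / 2 ≤ R ^ i * |q N| := by
    intro i
    induction i with
    | zero => simp; linarith
    | succ i ih =>
      obtain ⟨h1, h2⟩ := hN (N + i) (by lia)
      have h3 : |q (N + (i + 1))| ≤ R * |q (N + i)| + |ε (N + i)| := by
        rw [← add_assoc, hq]
        refine (abs_add_le _ _).trans ?_
        rw [abs_mul]
        gcongr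
      have h4 := mul_le_mul_of_nonneg_left ih hR0
      calc |q (N + (i + 1))| - δ / 2 ≤ R * (|q (N + i)| - δ / 2) := by linarith
        _ ≤ R * (R ^ i * |q N|) := h4
        _ = R ^ (i + 1) * |q N| := by ring
  have hpow : Tendsto (fun i : ℕ => R ^ i * |q N|) atTop (𝓝 0) := by
    simpa using (tendsto_pow_atTop_nhds_zero_of_lt_one hR0 hR1).mul_const |q N|
  obtain ⟨M, hM⟩ := eventually_atTop.1 (hpow.eventually_lt_const (half_pos hδ))
  refine ⟨N + M, fun n hn => ?_⟩
  obtain ⟨i, rfl⟩ : ∃ i, n = N + i := ⟨n - N, by lia⟩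
  have h1 := hstep i
  have h2 := hM i (by lia)
  rw [Real.dist_eq, sub_zero]
  linarith

/-- Comparison of the norming constants at `n` and `2 n`. -/
lemma tendsto_norming_two_mul {T τ : ℝ → ℝ} (hT : Antitone T) {a b : ℕ → ℝ} (ha : ∀ n, 0 < a n)
    {S : Set ℝ} (hS : IsOpen S) (hτ : StrictAntiOn τ S)
    (hlim : ∀ x ∈ S, Tendsto (fun n : ℕ => (n : ℝ) * T (a n * x + b n)) atTop (𝓝 (τ x)))
    {c : ℝ} (hc : ∀ x ∈ S, c * x ∈ S ∧ τ (c * x) = τ x / 2) {x₁ x₂ : ℝ} (h₁ : x₁ ∈ S)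
    (h₂ : x₂ ∈ S) (h₁₂ : x₁ ≠ x₂) :
    Tendsto (fun n => a (2 * n) / a n) atTop (𝓝 c) ∧
      Tendsto (fun n => (b (2 * n) - b n) / a n) atTop (𝓝 0) := by
  have key : ∀ x ∈ S, Tendsto (fun n => (a (2 * n) * x + b (2 * n) - b n) / a n) atTop
      (𝓝 (c * x)) := by
    intro x hx
    refine tendsto_of_tendsto_apply_of_antitone (φ := fun (n : ℕ) y => (n : ℝ) * T (a n * y + b n))
      hS (fun n y z h => ?_) hlim hτ (hc x hx).1 ?_
    · have := (ha n).le
      exact mul_le_mul_of_nonneg_left (hT (by gcongr)) n.cast_nonneg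
    · rw [(hc x hx).2]
      have h2 : Tendsto (fun n : ℕ => 2 * n) atTop atTop :=
        tendsto_id.const_mul_atTop' (by norm_num)
      have := ((hlim x hx).comp h2).div_const 2
      refine this.congr fun n => ?_
      have hn := (ha n).ne'
      simp only [Function.comp_apply, mul_div_cancel₀ _ hn, sub_add_cancel]
      push_cast
      ring
  have hsub : x₁ - x₂ ≠ 0 := sub_ne_zero.2 h₁₂
  have hA : Tendsto (fun n => a (2 * n) / a n) atTop (𝓝 c) := by
    have := ((key x₁ h₁).sub (key x₂ h₂)).div_const (x₁ - x₂)
    rw [← mul_sub, mul_div_cancel_right₀ _ hsub] at this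
    refine this.congr fun n => ?_
    have hn := (ha n).ne'
    field_simp
    ring
  refine ⟨hA, ?_⟩
  have := (key x₁ h₁).sub (hA.mul_const x₁)
  rw [sub_self] at this
  refine this.congr fun n => ?_
  have hn := (ha n).ne'
  field_simp
  ring

/-- In the Fréchet case the centering constants can be dropped along `n = 2^j`. -/
lemma exists_scaling_frechet {T τ : ℝ → ℝ} (hT : Antitone T) {a b : ℕ → ℝ} (ha : ∀ n, 0 < a n)
    (hτ : StrictAntiOn τ (Ioi 0)) (hτc : ∀ x ∈ Ioi (0 : ℝ), ContinuousAt τ x)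
    (hlim : ∀ x ∈ Ioi (0 : ℝ), Tendsto (fun n : ℕ => (n : ℝ) * T (a n * x + b n)) atTop (𝓝 (τ x)))
    {c : ℝ} (hc1 : 1 < c) (hc : ∀ x ∈ Ioi (0 : ℝ), τ (c * x) = τ x / 2) :
    ∃ s : ℕ → ℝ, (∀ j, 0 < s j) ∧ Tendsto s atTop atTop ∧
      ∀ x ∈ Ioi (0 : ℝ), Tendsto (fun j : ℕ => (2 : ℝ) ^ j * T (0 + s j * x)) atTop (𝓝 (τ x)) := by
  have hc0 : 0 < c := by linarith
  obtain ⟨hA, hB⟩ := tendsto_norming_two_mul hT ha isOpen_Ioi hτ hlim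
    (fun x hx => ⟨mul_pos hc0 hx, hc x hx⟩) (x₁ := 1) (x₂ := 2) (by simp) (by simp) (by norm_num)
  have hpow : Tendsto (fun j : ℕ => 2 ^ j) atTop (atTop : Filter ℕ) :=
    tendsto_pow_atTop_atTop_of_one_lt (by norm_num)
  have hA' := (hA.comp hpow).inv₀ hc0.ne'
  have hB' := hB.comp hpow
  have hq : Tendsto (fun j : ℕ => b (2 ^ j) / a (2 ^ j)) atTop (𝓝 0) := by
    refine tendsto_zero_of_recursion (inv_nonneg.2 hc0.le) (inv_lt_one_of_one_lt₀ hc1) hA'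
      (by simpa using hA'.mul hB') fun j => ?_
    have h1 := (ha (2 ^ j)).ne'
    have h2 := (ha (2 * 2 ^ j)).ne'
    simp only [Function.comp_apply, pow_succ']
    field_simp
    ring
  refine ⟨fun j => a (2 ^ j), fun j => ha _, ?_, fun x hx => ?_⟩
  · have : Tendsto (fun j : ℕ => (a (2 ^ j))⁻¹) atTop (𝓝 0) := by
      refine tendsto_zero_of_recursion (inv_nonneg.2 hc0.le) (inv_lt_one_of_one_lt₀ hc1) hA'
        tendsto_const_nhds fun j => ?_
      have h1 := (ha (2 ^ j)).ne'
      have h2 := (ha (2 * 2 ^ j)).ne'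
      simp only [Function.comp_apply, pow_succ']
      field_simp
      ring
    have h2 : Tendsto (fun j : ℕ => (a (2 ^ j))⁻¹) atTop (𝓝[>] 0) :=
      tendsto_nhdsWithin_iff.2 ⟨this, .of_forall fun j => inv_pos.2 (ha _)⟩
    simpa [Function.comp_def] using tendsto_inv_nhdsGT_zero.comp h2
  · have hy : Tendsto (fun j : ℕ => x - b (2 ^ j) / a (2 ^ j)) atTop (𝓝 x) := by
      simpa using hq.const_sub x
    have := tendsto_apply_of_antitone
      (φ := fun (j : ℕ) y => (2 : ℝ) ^ j * T (a (2 ^ j) * y + b (2 ^ j))) isOpen_Ioi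
      (fun j y z h => by
        have := (ha (2 ^ j)).le
        exact mul_le_mul_of_nonneg_left (hT (by gcongr)) (by positivity))
      (fun y hy => by simpa [Function.comp_def] using (hlim y hy).comp hpow) hx (hτc x hx) hy
    refine this.congr fun j => ?_
    have h1 := (ha (2 ^ j)).ne'
    congr 2
    field_simp
    ring

/-- In the Weibull case the centering constants can be replaced by their limit along `n = 2^j`. -/
lemma exists_scaling_weibull {T τ : ℝ → ℝ} (hT : Antitone T) {a b : ℕ → ℝ} (ha : ∀ n, 0 < a n)
    (hτ : StrictAntiOn τ (Iio 0)) (hτc : ∀ x ∈ Iio (0 : ℝ), ContinuousAt τ x)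
    (hlim : ∀ x ∈ Iio (0 : ℝ), Tendsto (fun n : ℕ => (n : ℝ) * T (a n * x + b n)) atTop (𝓝 (τ x)))
    {c : ℝ} (hc0 : 0 < c) (hc1 : c < 1) (hc : ∀ x ∈ Iio (0 : ℝ), τ (c * x) = τ x / 2) :
    ∃ (β : ℝ) (s : ℕ → ℝ), (∀ j, 0 < s j) ∧ Tendsto s atTop (𝓝 0) ∧
      ∀ x ∈ Iio (0 : ℝ), Tendsto (fun j : ℕ => (2 : ℝ) ^ j * T (β + s j * x)) atTop (𝓝 (τ x)) := by
  obtain ⟨hA, hB⟩ := tendsto_norming_two_mul hT ha isOpen_Iio hτ hlim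
    (fun x hx => ⟨mul_neg_of_pos_of_neg hc0 hx, hc x hx⟩) (x₁ := -1) (x₂ := -2) (by simp) (by simp)
    (by norm_num)
  have hpow : Tendsto (fun j : ℕ => 2 ^ j) atTop (atTop : Filter ℕ) :=
    tendsto_pow_atTop_atTop_of_one_lt (by norm_num)
  set s : ℕ → ℝ := fun j => a (2 ^ j) with hs
  set B : ℕ → ℝ := fun j => b (2 ^ j) with hBdef
  have hs0 : ∀ j, 0 < s j := fun j => ha _
  have hA' : Tendsto (fun j => s (j + 1) / s j) atTop (𝓝 c) := by
    simpa [Function.comp_def, hs, pow_succ'] using hA.comp hpow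
  have hB' : Tendsto (fun j => (B (j + 1) - B j) / s j) atTop (𝓝 0) := by
    simpa [Function.comp_def, hs, hBdef, pow_succ'] using hB.comp hpow
  have hsum : Summable s := by
    refine summable_of_ratio_test_tendsto_lt_one hc1 (.of_forall fun j => (hs0 j).ne') ?_
    simpa only [Real.norm_of_nonneg (hs0 _).le] using hA'
  have hsl : Tendsto s atTop (𝓝 0) := hsum.tendsto_atTop_zero
  have hsumB : Summable fun j => B (j + 1) - B j := by
    refine hsum.of_norm_bounded_eventually_nat ?_
    have := hB'.abs
    rw [abs_zero] at this
    filter_upwards [this.eventually_lt_const one_pos] with j hj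
    rw [abs_div, abs_of_pos (hs0 j), div_lt_one (hs0 j)] at hj
    exact hj.le
  obtain ⟨β, hβ⟩ : ∃ β, Tendsto B atTop (𝓝 β) := by
    have := hsumB.hasSum.tendsto_sum_nat
    simp only [Finset.sum_range_sub] at this
    exact ⟨_, by simpa using this.add_const (B 0)⟩
  -- for large `j` an increment of `B` is at most `δ / 2` times the decrement of `s`, so that
  -- `|β - B j| ≤ δ / 2 * s j` by telescoping
  have hq : Tendsto (fun j => (β - B j) / s j) atTop (𝓝 0) := by
    obtain ⟨R, hcR, hR1⟩ := exists_between hc1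
    have hR : 0 < 1 - R := by linarith
    rw [Metric.tendsto_atTop]
    intro δ hδ
    have hE : ∀ᶠ j in atTop, |(B (j + 1) - B j) / s j| < δ / 2 * (1 - R) := by
      have := hB'.abs
      rw [abs_zero] at this
      exact this.eventually_lt_const (by positivity)
    obtain ⟨N, hN⟩ := eventually_atTop.1 (hE.and (hA'.eventually_lt_const hcR))
    have hstep : ∀ j ≥ N, |B (j + 1) - B j| ≤ δ / 2 * s j - δ / 2 * s (j + 1) := by
      intro j hj
      obtain ⟨h1, h2⟩ := hN j hj
      rw [abs_div, abs_of_pos (hs0 j), div_lt_iff₀ (hs0 j)] at h1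
      rw [div_lt_iff₀ (hs0 j)] at h2
      have := mul_lt_mul_of_pos_left h2 (half_pos hδ)
      linarith
    refine ⟨N, fun j hj => ?_⟩
    have hle : ∀ i, |B (j + i) - B j| ≤ δ / 2 * s j - δ / 2 * s (j + i) := by
      intro i
      induction i with
      | zero => simp
      | succ i ih =>
        have h1 := hstep (j + i) (by lia)
        have h2 := abs_sub_le (B (j + i + 1)) (B (j + i)) (B j)
        rw [← add_assoc]
        linarith
    have hlimj : Tendsto (fun i => |B (j + i) - B j|) atTop (𝓝 |β - B j|) := by
      have : Tendsto (fun i => B (j + i)) atTop (𝓝 β) := by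
        simpa only [add_comm j] using (tendsto_add_atTop_iff_nat j).2 hβ
      exact (this.sub_const _).abs
    have hfin : |β - B j| ≤ δ / 2 * s j := by
      refine le_of_tendsto hlimj (.of_forall fun i => (hle i).trans ?_)
      have := hs0 (j + i)
      nlinarith
    rw [Real.dist_eq, sub_zero, abs_div, abs_of_pos (hs0 j), div_lt_iff₀ (hs0 j)]
    have := hs0 j
    nlinarith
  refine ⟨β, s, hs0, hsl, fun x hx => ?_⟩
  have hy : Tendsto (fun j => x + (β - B j) / s j) atTop (𝓝 x) := by
    simpa using hq.const_add x
  have := tendsto_apply_of_antitone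
    (φ := fun (j : ℕ) y => (2 : ℝ) ^ j * T (s j * y + B j)) isOpen_Iio
    (fun j y z h => by
      have := (hs0 j).le
      exact mul_le_mul_of_nonneg_left (hT (by gcongr)) (by positivity))
    (fun y hy => by simpa [Function.comp_def] using (hlim y hy).comp hpow) hx (hτc x hx) hy
  refine this.congr fun j => ?_
  have h1 := (hs0 j).ne'
  congr 2
  field_simp
  ring

/-- Regular variation of `T` at `β` (or at infinity) follows from its behaviour along the scales
`s j`: the values `2^j T(y)` with `1/2 ≤ 2^j T(y) ≤ 1` are relatively compact, and at each limit
point the limit function determines `(y - β) / s j`. -/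
lemma tendsto_tail_ratio_of_scaling {T τ : ℝ → ℝ} (hT : Antitone T) {S : Set ℝ} (hS : IsOpen S)
    (hτ : StrictAntiOn τ S) (hτc : ∀ x ∈ S, ContinuousAt τ x) (hsurj : SurjOn τ S (Ioi 0))
    {κ : ℝ} (hτm : ∀ x > 0, ∀ z ∈ S, x * z ∈ S ∧ τ (x * z) = x ^ κ * τ z) {β : ℝ} {s : ℕ → ℝ}
    (hs : ∀ j, 0 < s j)
    (hlim : ∀ x ∈ S, Tendsto (fun j : ℕ => (2 : ℝ) ^ j * T (β + s j * x)) atTop (𝓝 (τ x)))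
    {ι : Type*} {l : Filter ι} {y : ι → ℝ} (hy : Tendsto (fun i => T (y i)) l (𝓝[>] 0))
    {x : ℝ} (hx : 0 < x) :
    Tendsto (fun i => T (β + x * (y i - β)) / T (y i)) l (𝓝 (x ^ κ)) := by
  have hex : ∀ i, ∃ j : ℕ, 0 < T (y i) ∧ T (y i) ≤ 1 →
      (2 : ℝ) ^ j ≤ (T (y i))⁻¹ ∧ (T (y i))⁻¹ < 2 ^ (j + 1) := by
    intro i
    by_cases h : 0 < T (y i) ∧ T (y i) ≤ 1
    · obtain ⟨j, hj⟩ := exists_nat_pow_near (one_le_inv_iff₀.2 h) (one_lt_two (α := ℝ))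
      exact ⟨j, fun _ => hj⟩
    · exact ⟨0, fun h' => absurd h' h⟩
  choose j hj using hex
  have hgood : ∀ᶠ i in l, 0 < T (y i) ∧ T (y i) ≤ 1 := by
    filter_upwards [hy.eventually (Ioc_mem_nhdsGT one_pos)] with i hi using hi
  have hjt : Tendsto j l atTop := by
    have hinv := tendsto_inv_nhdsGT_zero.comp hy
    refine tendsto_atTop.2 fun M => ?_
    filter_upwards [hgood, hinv.eventually_ge_atTop ((2 : ℝ) ^ M)] with i hi (h : _ ≤ (T (y i))⁻¹)
    have := h.trans_lt (hj i hi).2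
    have := (pow_lt_pow_iff_right₀ (one_lt_two (α := ℝ))).1 this
    lia
  have hm : ∀ᶠ i in l, (2 : ℝ) ^ j i * T (y i) ∈ Icc (1 / 2 : ℝ) 1 := by
    filter_upwards [hgood] with i hi
    obtain ⟨h1, h2⟩ := hj i hi
    constructor
    · rw [inv_lt_iff_one_lt_mul₀ hi.1, pow_succ] at h2
      linarith
    · rwa [le_inv_comm₀ (by positivity) hi.1, ← one_div, le_div_iff₀ (by positivity), mul_comm] at h1
  rw [tendsto_iff_ultrafilter]
  intro U hU
  obtain ⟨m, hmI, hmU⟩ := isCompact_Icc.ultrafilter_le_nhds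
    (U.map fun i => (2 : ℝ) ^ j i * T (y i)) (le_principal_iff.2 (hU hm))
  have hmt : Tendsto (fun i => (2 : ℝ) ^ j i * T (y i)) U (𝓝 m) := hmU
  have hm0 : 0 < m := by linarith [hmI.1]
  obtain ⟨z, hzS, hz⟩ := hsurj hm0
  have hφ : ∀ i, Antitone fun w => (2 : ℝ) ^ j i * T (β + s (j i) * w) := fun i v w h => by
    have := (hs (j i)).le
    exact mul_le_mul_of_nonneg_left (hT (by gcongr)) (by positivity)
  have hlimU : ∀ w ∈ S, Tendsto (fun i => (2 : ℝ) ^ j i * T (β + s (j i) * w)) U (𝓝 (τ w)) :=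
    fun w hw => (hlim w hw).comp (hjt.mono_left hU)
  have hcancel : ∀ i, β + s (j i) * ((y i - β) / s (j i)) = y i := fun i => by
    rw [mul_div_cancel₀ _ (hs (j i)).ne']; ring
  have hw : Tendsto (fun i => (y i - β) / s (j i)) U (𝓝 z) := by
    refine tendsto_of_tendsto_apply_of_antitone hS hφ hlimU hτ hzS ?_
    simpa only [hcancel, hz] using hmt
  obtain ⟨hxz, hτxz⟩ := hτm x hx z hzS
  have hnum := tendsto_apply_of_antitone hS hφ hlimU hxz (hτc _ hxz) (hw.const_mul x)
  have hquot := hnum.div hmt hm0.ne'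
  rw [hτxz, hz, mul_div_cancel_right₀ _ hm0.ne'] at hquot
  refine hquot.congr fun i => ?_
  have h2 : (2 : ℝ) ^ j i ≠ 0 := by positivity
  have h3 : s (j i) * (x * ((y i - β) / s (j i))) = x * (y i - β) := by
    have := (hs (j i)).ne'
    field_simp
  simp only [Pi.div_apply]
  rw [mul_div_mul_left _ _ h2, h3]

/-! ### The Fréchet domain -/

/-- The tail level `(k! / n)^{1/k}` at which the norming constants are quantiles of `F`. -/
noncomputable def tailLevel (k n : ℕ) : ℝ := ((k.factorial : ℝ) / (n : ℝ)) ^ (1 / (k : ℝ))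

lemma tendsto_tailLevel {k : ℕ} (hk : 1 ≤ k) : Tendsto (tailLevel k) atTop (𝓝[>] 0) := by
  have hk' : (0 : ℝ) < 1 / k := by positivity
  refine tendsto_nhdsWithin_iff.2 ⟨?_, ?_⟩
  · have h := (tendsto_const_div_atTop_nhds_zero_nat (k.factorial : ℝ)).rpow_const
      (p := 1 / (k : ℝ)) (.inr hk'.le)
    rwa [Real.zero_rpow hk'.ne'] at h
  · filter_upwards [eventually_gt_atTop 0] with n hn
    exact Real.rpow_pos_of_pos (by positivity) _

lemma tendsto_mul_tailLevel_pow {k : ℕ} (hk : 1 ≤ k) :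
    Tendsto (fun n : ℕ => (n : ℝ) * tailLevel k n ^ k) atTop (𝓝 (k.factorial : ℝ)) := by
  refine tendsto_const_nhds.congr' ?_
  filter_upwards [eventually_gt_atTop 0] with n hn
  have hn' : (n : ℝ) ≠ 0 := by positivity
  rw [tailLevel, one_div, Real.rpow_inv_natCast_pow (by positivity) (by lia)]
  field_simp

lemma eventually_tail_quantile_eq {F : ℝ → ℝ} (hF : IsDF F) (hc : Continuous F) {u : ℕ → ℝ}
    (hu : Tendsto u atTop (𝓝[>] 0)) :
    ∀ᶠ n in atTop, 1 - F (quantile F (1 - u n)) = u n := by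
  filter_upwards [hu.eventually (Ioo_mem_nhdsGT one_pos)] with n hn
  rw [hF.apply_quantile hc (by linarith [hn.2]) (by linarith [hn.1])]
  ring

lemma tendsto_tail_frechet {F : ℝ → ℝ} (hF : IsDF F) {α : ℝ} {a b : ℕ → ℝ}
    (h : MaxConverges F (frechet α) a b) :
    ∀ x ∈ Ioi (0 : ℝ), Tendsto (fun n : ℕ => (n : ℝ) * (1 - F (a n * x + b n))) atTop
      (𝓝 (x ^ (-α))) := by
  intro x hx
  have hx' : 0 < x := hx
  have hcont : ContinuousAt (frechet α) x := by
    have h1 : ContinuousAt (fun y : ℝ => Real.exp (-(y ^ (-α)))) x :=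
      Real.continuous_exp.continuousAt.comp (Real.continuousAt_rpow_const _ _ (.inl hx'.ne')).neg
    refine h1.congr ?_
    filter_upwards [lt_mem_nhds hx'] with y hy
    rw [frechet, if_pos hy]
  refine tendsto_mul_one_sub_of_tendsto_pow (fun n => hF.nonneg _) ?_
  have := h.2 x hcont
  rwa [frechet, if_pos hx'] at this

lemma strictAntiOn_rpow_neg {α : ℝ} (hα : 0 < α) :
    StrictAntiOn (fun x : ℝ => x ^ (-α)) (Ioi 0) :=
  fun _ hx _ _ h => Real.rpow_lt_rpow_of_neg hx h (neg_lt_zero.2 hα)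

lemma surjOn_rpow {β : ℝ} (hβ : β ≠ 0) : SurjOn (fun x : ℝ => x ^ β) (Ioi 0) (Ioi 0) :=
  fun m (hm : 0 < m) => ⟨m ^ β⁻¹, Real.rpow_pos_of_pos hm _, Real.rpow_inv_rpow hm.le hβ⟩

lemma frechet_domain {F : ℝ → ℝ} (hF : IsDF F) (hc : Continuous F) {k : ℕ} (hk : 1 ≤ k)
    {α : ℝ} (hα : 0 < α) (h : InMaxDomain F (frechet α)) :
    rightEnd F = ⊤ ∧ MaxConverges (upperDF F k) (frechet (k * α))
      (fun n => quantile F (1 - tailLevel k n)) (fun _ => 0) := by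
  obtain ⟨a, b, ha, hab⟩ := h
  have hT := hF.antitone_tail
  have hτc : ∀ x ∈ Ioi (0 : ℝ), ContinuousAt (fun x : ℝ => x ^ (-α)) x := fun x hx =>
    Real.continuousAt_rpow_const _ _ (.inl (ne_of_gt hx))
  obtain ⟨s, hs, hst, hlim⟩ := exists_scaling_frechet hT ha (strictAntiOn_rpow_neg hα) hτc
    (tendsto_tail_frechet hF hab) (c := 2 ^ α⁻¹) (Real.one_lt_rpow one_lt_two (inv_pos.2 hα))
    (fun x hx => by
      have hx' : 0 < x := hx
      rw [Real.mul_rpow (by positivity) hx'.le, ← Real.rpow_mul (by norm_num), mul_neg,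
        inv_mul_cancel₀ hα.ne', Real.rpow_neg_one]
      ring)
  have hlt : ∀ x, F x < 1 := by
    intro x
    obtain ⟨j, hj1, hj2⟩ := ((hst.eventually_ge_atTop x).and
      ((hlim 1 (mem_Ioi.2 one_pos)).eventually_const_lt (by simp : (0 : ℝ) < 1 ^ (-α)))).exists
    have h1 : 0 < 1 - F (0 + s j * 1) := (pos_iff_pos_of_mul_pos hj2).1 (by positivity)
    have h2 : F x ≤ F (0 + s j * 1) := hF.mono (by linarith)
    linarith
  have hu := tendsto_tailLevel hk
  set c : ℕ → ℝ := fun n => quantile F (1 - tailLevel k n) with hcdef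
  have hcu : ∀ᶠ n in atTop, 1 - F (c n) = tailLevel k n := eventually_tail_quantile_eq hF hc hu
  have hTc : Tendsto (fun n => 1 - F (c n)) atTop (𝓝[>] 0) :=
    hu.congr' (hcu.mono fun n hn => hn.symm)
  have hcpos : ∀ᶠ n in atTop, 0 < c n := by
    have h0 : 0 < 1 - F 0 := by linarith [hlt 0]
    filter_upwards [(tendsto_nhds_of_tendsto_nhdsWithin hTc).eventually_lt_const h0] with n hn
    exact hT.reflect_lt hn
  refine ⟨?_, hcpos, fun x _ => ?_⟩
  · refine EReal.eq_top_iff_forall_lt _ |>.2 fun x => ?_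
    exact (lt_rightEnd_iff hF hc x).2 (hlt x)
  simp only [add_zero]
  rcases lt_or_ge 0 x with hx | hx
  · have hratio := tendsto_tail_ratio_of_scaling hT isOpen_Ioi (strictAntiOn_rpow_neg hα) hτc
      (surjOn_rpow (neg_ne_zero.2 hα.ne')) (κ := -α)
      (fun x hx z hz => ⟨mul_pos hx hz, Real.mul_rpow (le_of_lt hx) (le_of_lt hz)⟩) hs hlim hTc hx
    have hratio' : Tendsto (fun n => (1 - F (c n * x)) / tailLevel k n) atTop (𝓝 (x ^ (-α))) := by
      refine hratio.congr' ?_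
      filter_upwards [hcu] with n hn
      rw [hn, sub_zero, zero_add, mul_comm]
    have := tendsto_pow_of_tendsto_mul_one_sub (tendsto_mul_tail_upperDF hF hc
      (Real.rpow_pos_of_pos hx _) hu (tendsto_mul_tailLevel_pow hk) hratio')
    rw [frechet, if_pos hx]
    convert this using 4
    rw [← Real.rpow_mul_natCast hx.le]
    ring_nf
  · rw [frechet, if_neg hx.not_gt]
    have hD := isDF_upperDF hF hc hk
    have h1 : upperDF F k 0 < 1 := (upperFun_lt_one_iff hk (hF.nonneg 0) (hF.le_one 0)).2 (hlt 0)
    refine squeeze_zero' (.of_forall fun n => pow_nonneg (hD.nonneg _) n) ?_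
      (tendsto_pow_atTop_nhds_zero_of_lt_one (hD.nonneg 0) h1)
    filter_upwards [hcpos] with n hn
    exact pow_le_pow_left₀ (hD.nonneg _) (hD.mono (mul_nonpos_of_nonneg_of_nonpos hn.le hx)) n

/-! ### The Weibull domain -/

lemma tendsto_tail_weibull {F : ℝ → ℝ} (hF : IsDF F) {α : ℝ} {a b : ℕ → ℝ}
    (h : MaxConverges F (weibull α) a b) :
    ∀ x ∈ Iio (0 : ℝ), Tendsto (fun n : ℕ => (n : ℝ) * (1 - F (a n * x + b n))) atTop
      (𝓝 ((-x) ^ α)) := by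
  intro x hx
  have hx' : x < 0 := hx
  have hform : ∀ y < 0, weibull α y = Real.exp (-((-y) ^ α)) := fun y hy => by
    rw [weibull, if_pos hy, abs_of_neg hy]
  have hcont : ContinuousAt (weibull α) x := by
    have h1 : ContinuousAt (fun y : ℝ => Real.exp (-((-y) ^ α))) x :=
      Real.continuous_exp.continuousAt.comp
        (continuousAt_id.neg.rpow_const (.inl (neg_ne_zero.2 hx'.ne))).neg
    refine h1.congr ?_
    filter_upwards [gt_mem_nhds hx'] with y hy using (hform y hy).symm
  refine tendsto_mul_one_sub_of_tendsto_pow (fun n => hF.nonneg _) ?_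
  have := h.2 x hcont
  rwa [hform x hx'] at this

lemma strictAntiOn_neg_rpow {α : ℝ} (hα : 0 < α) :
    StrictAntiOn (fun x : ℝ => (-x) ^ α) (Iio 0) :=
  fun _ _ _ (hy : _ < 0) h => Real.rpow_lt_rpow (neg_nonneg.2 hy.le) (neg_lt_neg h) hα

lemma weibull_domain {F : ℝ → ℝ} (hF : IsDF F) (hc : Continuous F) {k : ℕ} (hk : 1 ≤ k)
    {α : ℝ} (hα : 0 < α) (h : InMaxDomain F (weibull α)) :
    rightEnd F < ⊤ ∧ MaxConverges (upperDF F k) (weibull (k * α))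
      (fun n => (rightEnd F).toReal - quantile F (1 - tailLevel k n))
      (fun _ => (rightEnd F).toReal) := by
  obtain ⟨a, b, ha, hab⟩ := h
  have hT := hF.antitone_tail
  have hτc : ∀ x ∈ Iio (0 : ℝ), ContinuousAt (fun x : ℝ => (-x) ^ α) x := fun x hx =>
    continuousAt_id.neg.rpow_const (.inl (neg_ne_zero.2 (ne_of_lt hx)))
  have hm : ∀ x > 0, ∀ z ∈ Iio (0 : ℝ), x * z ∈ Iio (0 : ℝ) ∧ (-(x * z)) ^ α = x ^ α * (-z) ^ α :=
    fun x hx z (hz : z < 0) => ⟨mul_neg_of_pos_of_neg hx hz, by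
      rw [← mul_neg, Real.mul_rpow (le_of_lt hx) (by linarith)]⟩
  obtain ⟨β, s, hs, hst, hlim⟩ := exists_scaling_weibull hT ha (strictAntiOn_neg_rpow hα) hτc
    (tendsto_tail_weibull hF hab) (c := 2 ^ (-α⁻¹)) (by positivity)
    (Real.rpow_lt_one_of_one_lt_of_neg one_lt_two (neg_lt_zero.2 (inv_pos.2 hα)))
    (fun x hx => by
      rw [(hm _ (by positivity) x hx).2, ← Real.rpow_mul (by norm_num), neg_mul,
        inv_mul_cancel₀ hα.ne', Real.rpow_neg_one]
      ring)
  have hlim1 : Tendsto (fun j : ℕ => (2 : ℝ) ^ j * (1 - F (β + s j * -1))) atTop (𝓝 1) := by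
    simpa using hlim (-1) (by simp)
  have hβ : F β = 1 := by
    refine le_antisymm (hF.le_one β) (not_lt.1 fun hlt => ?_)
    have h0 : 0 < 1 - F β := by linarith
    have h1 : Tendsto (fun j : ℕ => (2 : ℝ) ^ j * (1 - F β)) atTop atTop :=
      (tendsto_pow_atTop_atTop_of_one_lt one_lt_two).atTop_mul_const h0
    refine not_tendsto_nhds_of_tendsto_atTop (tendsto_atTop_mono (fun j => ?_) h1) 1 hlim1
    exact mul_le_mul_of_nonneg_left (hT (by linarith [hs j])) (by positivity)
  have hlt : ∀ x, F x < 1 ↔ x < β := by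
    intro x
    constructor
    · intro hx
      exact hF.mono.reflect_lt (by rwa [hβ])
    · intro hx
      obtain ⟨j, hj1, hj2⟩ := ((hst.eventually_lt_const (sub_pos.2 hx)).and
        (hlim1.eventually_const_lt one_pos)).exists
      have h1 : 0 < 1 - F (β + s j * -1) := (pos_iff_pos_of_mul_pos hj2).1 (by positivity)
      have h2 : F x ≤ F (β + s j * -1) := hF.mono (by linarith)
      linarith
  have hr : rightEnd F = (β : EReal) := by
    refine le_antisymm (sSup_le ?_) (le_of_forall_lt_imp_le_of_dense fun y hy => ?_)
    · rintro _ ⟨x, hx, rfl⟩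
      exact EReal.coe_le_coe_iff.2 ((hlt x).1 hx).le
    · obtain ⟨x, hyx, hxβ⟩ := EReal.lt_iff_exists_real_btwn.1 hy
      exact hyx.le.trans
        (((lt_rightEnd_iff hF hc x).2 ((hlt x).2 (EReal.coe_lt_coe_iff.1 hxβ))).le)
  rw [hr, EReal.toReal_coe]
  have hu := tendsto_tailLevel hk
  set c : ℕ → ℝ := fun n => quantile F (1 - tailLevel k n) with hcdef
  have hcu : ∀ᶠ n in atTop, 1 - F (c n) = tailLevel k n := eventually_tail_quantile_eq hF hc hu
  have hTc : Tendsto (fun n => 1 - F (c n)) atTop (𝓝[>] 0) :=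
    hu.congr' (hcu.mono fun n hn => hn.symm)
  have hcpos : ∀ᶠ n in atTop, 0 < β - c n := by
    filter_upwards [hTc.eventually self_mem_nhdsWithin] with n (hn : 0 < 1 - F (c n))
    exact sub_pos.2 ((hlt _).1 (by linarith))
  refine ⟨EReal.coe_lt_top β, hcpos, fun x _ => ?_⟩
  rcases lt_or_ge x 0 with hx | hx
  · have hratio := tendsto_tail_ratio_of_scaling hT isOpen_Iio (strictAntiOn_neg_rpow hα) hτc
      (fun m hm => by
        obtain ⟨y, hy, hym⟩ := surjOn_rpow hα.ne' hm
        exact ⟨-y, mem_Iio.2 (neg_lt_zero.2 hy), by simpa using hym⟩)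
      (κ := α) hm hs hlim hTc (neg_pos.2 hx)
    have hratio' : Tendsto (fun n => (1 - F ((β - c n) * x + β)) / tailLevel k n) atTop
        (𝓝 ((-x) ^ α)) := by
      refine hratio.congr' ?_
      filter_upwards [hcu] with n hn
      rw [hn]
      ring_nf
    have := tendsto_pow_of_tendsto_mul_one_sub (tendsto_mul_tail_upperDF hF hc
      (Real.rpow_pos_of_pos (neg_pos.2 hx) _) hu (tendsto_mul_tailLevel_pow hk) hratio')
    rw [weibull, if_pos hx, abs_of_neg hx]
    convert this using 4
    rw [← Real.rpow_mul_natCast (neg_pos.2 hx).le]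
    ring_nf
  · rw [weibull, if_neg hx.not_gt]
    refine tendsto_const_nhds.congr' ?_
    filter_upwards [hcpos] with n hn
    have h1 : F ((β - c n) * x + β) = 1 :=
      le_antisymm (hF.le_one _) (by rw [← hβ]; exact hF.mono (by nlinarith))
    rw [upperDF_eq, h1, upperFun_one hk, one_pow]

/-! ### Auxiliary functions in the Gumbel domain -/

lemma tendsto_tail_gumbel {F : ℝ → ℝ} (hF : IsDF F) {a b : ℕ → ℝ}
    (h : MaxConverges F gumbel a b) (x : ℝ) :
    Tendsto (fun n : ℕ => (n : ℝ) * (1 - F (a n * x + b n))) atTop (𝓝 (Real.exp (-x))) := by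
  have hcont : Continuous gumbel := by unfold gumbel; fun_prop
  exact tendsto_mul_one_sub_of_tendsto_pow (fun n => hF.nonneg _) (h.2 x hcont.continuousAt)

lemma strictAntiOn_exp_neg : StrictAntiOn (fun x : ℝ => Real.exp (-x)) univ :=
  fun _ _ _ _ h => Real.exp_lt_exp.2 (neg_lt_neg h)

lemma continuous_exp_neg : Continuous fun x : ℝ => Real.exp (-x) := by fun_prop

/-- A positive function `v` with the limit relation of an auxiliary function for all real `x`, not
only for `x ≥ 0`. -/
structure IsTwoSidedAuxiliary (F v : ℝ → ℝ) : Prop where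
  pos : ∀ t, 0 < v t
  tendsto : ∀ x, Tendsto (fun t => (1 - F (t + v t * x)) / (1 - F t)) (toRightEnd F)
    (𝓝 (Real.exp (-x)))

/-- The scale `a_n` at `n = ⌊1 / (1 - F t)⌋` serves as an auxiliary function, since then
`t = a_n y + b_n` with `y → 0`. -/
lemma exists_isTwoSidedAuxiliary {F : ℝ → ℝ} (hF : IsDF F) (hc : Continuous F)
    (h : InMaxDomain F gumbel) : ∃ v, IsTwoSidedAuxiliary F v := by
  obtain ⟨a, b, ha, hab⟩ := h
  set N : ℝ → ℕ := fun t => ⌊(1 - F t)⁻¹⌋₊ with hN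
  have hT := tendsto_tail_toRightEnd hF hc
  have hinv : Tendsto (fun t => (1 - F t)⁻¹) (toRightEnd F) atTop := tendsto_inv_nhdsGT_zero.comp hT
  have hNt : Tendsto N (toRightEnd F) atTop := tendsto_nat_floor_atTop.comp hinv
  have hNT : Tendsto (fun t => (N t : ℝ) * (1 - F t)) (toRightEnd F) (𝓝 1) := by
    have := (tendsto_nat_floor_div_atTop (R := ℝ)).comp hinv
    refine this.congr fun t => ?_
    simp [hN]
  have hφ : ∀ t, Antitone fun y => (N t : ℝ) * (1 - F (a (N t) * y + b (N t))) := fun t y z hyz => by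
    have := (ha (N t)).le
    exact mul_le_mul_of_nonneg_left (hF.antitone_tail (by gcongr)) (Nat.cast_nonneg _)
  have hlim : ∀ y ∈ univ, Tendsto (fun t => (N t : ℝ) * (1 - F (a (N t) * y + b (N t))))
      (toRightEnd F) (𝓝 (Real.exp (-y))) := fun y _ => (tendsto_tail_gumbel hF hab y).comp hNt
  have hcancel : ∀ t, a (N t) * ((t - b (N t)) / a (N t)) + b (N t) = t := fun t => by
    rw [mul_div_cancel₀ _ (ha (N t)).ne']; ring
  have hw : Tendsto (fun t => (t - b (N t)) / a (N t)) (toRightEnd F) (𝓝 0) := by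
    refine tendsto_of_tendsto_apply_of_antitone isOpen_univ hφ hlim strictAntiOn_exp_neg
      (mem_univ 0) ?_
    simpa only [hcancel, neg_zero, Real.exp_zero] using hNT
  refine ⟨fun t => a (N t), fun t => ha _, fun x => ?_⟩
  have hwx : Tendsto (fun t => (t - b (N t)) / a (N t) + x) (toRightEnd F) (𝓝 x) := by
    simpa using hw.add_const x
  have hnum := tendsto_apply_of_antitone isOpen_univ hφ hlim (mem_univ x)
    continuous_exp_neg.continuousAt hwx
  have hq := hnum.div hNT one_ne_zero
  rw [div_one] at hq
  refine hq.congr' ?_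
  filter_upwards [hNt.eventually_gt_atTop 0] with t ht
  have ht' : (N t : ℝ) ≠ 0 := by positivity
  simp only [Pi.div_apply]
  rw [mul_div_mul_left _ _ ht', mul_add, add_right_comm, hcancel]

lemma antitone_tail_ratio {F v : ℝ → ℝ} (hF : IsDF F) (hv : ∀ t, 0 < v t) (t : ℝ) :
    Antitone fun y => (1 - F (t + v t * y)) / (1 - F t) := fun y z h => by
  have := (hv t).le
  have h0 : 0 ≤ 1 - F t := by linarith [hF.le_one t]
  exact div_le_div_of_nonneg_right (hF.antitone_tail (by gcongr)) h0

/-- Only the relation at `x = 1` is needed to identify `w` up to asymptotic equivalence. -/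
lemma IsTwoSidedAuxiliary.tendsto_div {F v w : ℝ → ℝ} (hF : IsDF F)
    (hv : IsTwoSidedAuxiliary F v)
    (hw : Tendsto (fun t => (1 - F (t + w t)) / (1 - F t)) (toRightEnd F) (𝓝 (Real.exp (-1)))) :
    Tendsto (fun t => w t / v t) (toRightEnd F) (𝓝 1) := by
  refine tendsto_of_tendsto_apply_of_antitone isOpen_univ (antitone_tail_ratio hF hv.pos)
    (fun x _ => hv.tendsto x) strictAntiOn_exp_neg (mem_univ 1) ?_
  simpa only [mul_div_cancel₀ _ (hv.pos _).ne'] using hw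

lemma IsTwoSidedAuxiliary.tendsto_of_tendsto_div {F v w : ℝ → ℝ} (hF : IsDF F)
    (hv : IsTwoSidedAuxiliary F v) (hw : Tendsto (fun t => w t / v t) (toRightEnd F) (𝓝 1))
    (x : ℝ) : Tendsto (fun t => (1 - F (t + w t * x)) / (1 - F t)) (toRightEnd F)
      (𝓝 (Real.exp (-x))) := by
  have hwx : Tendsto (fun t => w t / v t * x) (toRightEnd F) (𝓝 x) := by
    simpa using hw.mul_const x
  have := tendsto_apply_of_antitone isOpen_univ (antitone_tail_ratio hF hv.pos)
    (fun x _ => hv.tendsto x) (mem_univ x) continuous_exp_neg.continuousAt hwx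
  simpa only [← mul_assoc, mul_div_cancel₀ _ (hv.pos _).ne'] using this

/-- With `b_n` the quantile of `F_k` at `1 - 1/n`, one has `n (1 - F(b_n))^k → k!`, and the tail of
`F` decreases by the factor `e^{-x/k}` from `b_n` to `b_n + v(b_n) x / k`. -/
lemma maxConverges_gumbel_of_isAuxiliary {F v : ℝ → ℝ} (hF : IsDF F) (hc : Continuous F) {k : ℕ}
    (hk : 1 ≤ k) (hcomp : Continuous (upperDF F k)) (h : InMaxDomain F gumbel)
    (hv : IsAuxiliary F v) :
    MaxConverges (upperDF F k) gumbel
      (fun n => v (quantile (upperDF F k) (1 - 1 / (n : ℝ))) / (k : ℝ))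
      (fun n => quantile (upperDF F k) (1 - 1 / (n : ℝ))) := by
  obtain ⟨v₀, hv₀⟩ := exists_isTwoSidedAuxiliary hF hc h
  have hvx := hv₀.tendsto_of_tendsto_div hF (hv₀.tendsto_div hF
    (by simpa using hv.2 1 zero_le_one))
  have hD := isDF_upperDF hF hc hk
  have hk0 : (0 : ℝ) < k := by positivity
  set b : ℕ → ℝ := fun n => quantile (upperDF F k) (1 - 1 / (n : ℝ)) with hb
  have hn1 : Tendsto (fun n : ℕ => 1 / (n : ℝ)) atTop (𝓝[>] 0) := by
    refine tendsto_nhdsWithin_iff.2 ⟨tendsto_const_div_atTop_nhds_zero_nat 1, ?_⟩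
    filter_upwards [eventually_gt_atTop 0] with n hn
    exact mem_Ioi.2 (by positivity)
  have hbn : ∀ᶠ n : ℕ in atTop, 1 - upperDF F k (b n) = 1 / (n : ℝ) :=
    eventually_tail_quantile_eq hD hcomp hn1
  have hbr : Tendsto b atTop (toRightEnd F) := by
    have h1 : Tendsto b atTop (toRightEnd (upperDF F k)) :=
      (tendsto_toRightEnd_iff hD hcomp).2 (hn1.congr' (hbn.mono fun n hn => hn.symm))
    rwa [toRightEnd, rightEnd_upperDF hF hk, ← toRightEnd] at h1
  have hu := (tendsto_toRightEnd_iff hF hc).1 hbr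
  have hupos : ∀ᶠ n in atTop, 0 < 1 - F (b n) := hu.eventually self_mem_nhdsWithin
  have huk : Tendsto (fun n : ℕ => (n : ℝ) * (1 - F (b n)) ^ k) atTop (𝓝 (k.factorial : ℝ)) := by
    have h1 := ((tendsto_tail_upperDF_ratio hF hc k).comp hbr).inv₀ (by positivity)
    rw [one_div, inv_inv] at h1
    refine h1.congr' ?_
    filter_upwards [hbn, eventually_gt_atTop 0] with n hn hn0
    simp only [Function.comp_apply]
    rw [hn, inv_div, div_div_eq_mul_div, div_one, mul_comm]
  refine ⟨?_, fun x _ => ?_⟩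
  · filter_upwards [hupos] with n hn
    exact div_pos (hv.1 _ ((lt_rightEnd_iff hF hc _).2 (by linarith))) hk0
  · have hp := (hvx (x / k)).comp hbr
    have h2 := tendsto_pow_of_tendsto_mul_one_sub
      (tendsto_mul_tail_upperDF hF hc (Real.exp_pos _) hu huk hp)
    rw [← Real.exp_nat_mul] at h2
    have h3 : (k : ℝ) * -(x / k) = -x := by field_simp
    rw [h3] at h2
    refine h2.congr fun n => ?_
    congr 2
    ring

/-! ### The mean residual life -/

/-- Auxiliary functions vary slowly on their own scale. -/
lemma IsTwoSidedAuxiliary.tendsto_shift {F v : ℝ → ℝ} (hF : IsDF F) (hc : Continuous F)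
    (hv : IsTwoSidedAuxiliary F v) (x : ℝ) :
    Tendsto (fun t => t + v t * x) (toRightEnd F) (toRightEnd F) ∧
      Tendsto (fun t => v (t + v t * x) / v t) (toRightEnd F) (𝓝 1) := by
  have hT := tendsto_tail_toRightEnd hF hc
  have hpos : ∀ᶠ t in toRightEnd F, 0 < 1 - F t := hT.eventually self_mem_nhdsWithin
  have hsh : Tendsto (fun t => t + v t * x) (toRightEnd F) (toRightEnd F) := by
    rw [tendsto_toRightEnd_iff hF hc, tendsto_nhdsWithin_iff]
    constructor
    · have := (hv.tendsto x).mul (tendsto_nhds_of_tendsto_nhdsWithin hT)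
      rw [mul_zero] at this
      refine this.congr' ?_
      filter_upwards [hpos] with t ht
      exact div_mul_cancel₀ _ ht.ne'
    · filter_upwards [hpos, (hv.tendsto x).eventually_const_lt (Real.exp_pos _)] with t ht h
      exact (div_pos_iff_of_pos_right ht).1 h
  refine ⟨hsh, ?_⟩
  have hprod := ((hv.tendsto 1).comp hsh).mul (hv.tendsto x)
  have hadd : Tendsto (fun t => x + v (t + v t * x) / v t) (toRightEnd F) (𝓝 (x + 1)) := by
    refine tendsto_of_tendsto_apply_of_antitone isOpen_univ (antitone_tail_ratio hF hv.pos)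
      (fun x _ => hv.tendsto x) strictAntiOn_exp_neg (mem_univ (x + 1)) ?_
    rw [← Real.exp_add, ← neg_add_rev] at hprod
    refine hprod.congr' ?_
    filter_upwards [hpos, hsh.eventually hpos] with t ht ht'
    simp only [Function.comp_apply, mul_one]
    rw [div_mul_div_cancel₀ ht'.ne', mul_add, mul_div_cancel₀ _ (hv.pos t).ne', ← add_assoc]
  simpa using hadd.sub_const x

/-- Each step `t ↦ t + v t` halves both the tail and its product with `v`, so that the integral of
the tail is dominated by a geometric series. -/
lemma IsTwoSidedAuxiliary.integral_tail_le {F v : ℝ → ℝ} (hF : IsDF F) (hc : Continuous F)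
    (hv : IsTwoSidedAuxiliary F v) :
    ∃ δ > 0, ∀ t, 0 < 1 - F t → 1 - F t < δ → ∀ y, t ≤ y →
      ∫ s in t..y, (1 - F s) ≤ 2 * (v t * (1 - F t)) := by
  have hT := tendsto_tail_toRightEnd hF hc
  have hpos : ∀ᶠ t in toRightEnd F, 0 < 1 - F t := hT.eventually self_mem_nhdsWithin
  obtain ⟨hsh, hvv⟩ := hv.tendsto_shift hF hc 1
  have he : Real.exp (-1) < 1 / 2 := by
    rw [Real.exp_neg, one_div]
    exact inv_strictAnti₀ two_pos (by linarith [Real.add_one_lt_exp one_ne_zero])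
  have hprod := hvv.mul (hv.tendsto 1)
  rw [one_mul] at hprod
  have hev : ∀ᶠ t in toRightEnd F, 0 < 1 - F (t + v t) ∧ 1 - F (t + v t) ≤ (1 - F t) / 2 ∧
      v (t + v t) * (1 - F (t + v t)) ≤ v t * (1 - F t) / 2 := by
    filter_upwards [hpos, hsh.eventually hpos, (hv.tendsto 1).eventually_lt_const he,
      hprod.eventually_lt_const he] with t h1 h2 h3 h4
    simp only [mul_one] at h2 h3 h4
    have := hv.pos t
    rw [div_lt_iff₀ h1] at h3
    rw [div_mul_div_comm, div_lt_iff₀ (by positivity)] at h4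
    exact ⟨h2, by linarith, by linarith⟩
  rw [toRightEnd_eq hF hc] at hev
  obtain ⟨δ, hδ, hδ'⟩ := ((nhdsGT_basis (0 : ℝ)).comap (fun x => 1 - F x)).eventually_iff.1 hev
  refine ⟨δ, hδ, ?_⟩
  have hint : ∀ x y, IntervalIntegrable (fun s => 1 - F s) volume x y := fun x y =>
    (continuous_const.sub hc).intervalIntegrable x y
  have htriv : ∀ t y, t ≤ y → ∫ s in t..y, (1 - F s) ≤ (1 - F t) * (y - t) := by
    intro t y hty
    have h1 := intervalIntegral.integral_mono_on hty (hint t y)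
      (intervalIntegrable_const (c := 1 - F t)) fun s hs => hF.antitone_tail hs.1
    rw [intervalIntegral.integral_const, smul_eq_mul, mul_comm] at h1
    exact h1
  have key : ∀ N : ℕ, ∀ t, 0 < 1 - F t → 1 - F t < δ → ∀ y, t ≤ y →
      ∫ s in t..y, (1 - F s) ≤ 2 * (v t * (1 - F t)) + (1 / 2) ^ N * ((1 - F t) * (y - t)) := by
    intro N
    induction N with
    | zero =>
      intro t ht _ y hty
      have := htriv t y hty
      have := mul_pos (hv.pos t) ht
      linarith
    | succ N ih =>
      intro t ht htδ y hty
      obtain ⟨h1, h2, h3⟩ := hδ' (show t ∈ (fun x => 1 - F x) ⁻¹' Ioo 0 δ from ⟨ht, htδ⟩)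
      have hvt := hv.pos t
      have hfirst := htriv t (t + v t) (by linarith)
      rw [add_sub_cancel_left, mul_comm] at hfirst
      have hrest : 0 ≤ (1 / 2 : ℝ) ^ (N + 1) * ((1 - F t) * (y - t)) := by
        have : 0 ≤ y - t := by linarith
        positivity
      rcases le_total y (t + v t) with hy | hy
      · have := htriv t y hty
        have h4 : (1 - F t) * (y - t) ≤ (1 - F t) * v t := by
          gcongr
          linarith
        have := mul_pos hvt ht
        linarith
      · have h4 := ih (t + v t) h1 (by linarith) y hy
        have h5 : (1 - F (t + v t)) * (y - (t + v t)) ≤ (1 - F t) / 2 * (y - t) :=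
          mul_le_mul h2 (by linarith) (by linarith) (by linarith)
        have h6 := mul_le_mul_of_nonneg_left h5 (by positivity : (0 : ℝ) ≤ (1 / 2) ^ N)
        rw [← intervalIntegral.integral_add_adjacent_intervals (hint t (t + v t)) (hint _ y)]
        have h7 : (1 / 2 : ℝ) ^ N * ((1 - F t) / 2 * (y - t)) =
            (1 / 2) ^ (N + 1) * ((1 - F t) * (y - t)) := by ring
        linarith
  intro t ht htδ y hty
  have hlim : Tendsto (fun N : ℕ => 2 * (v t * (1 - F t)) +
      (1 / 2 : ℝ) ^ N * ((1 - F t) * (y - t))) atTop (𝓝 (2 * (v t * (1 - F t)))) := by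
    have := (tendsto_pow_atTop_nhds_zero_of_lt_one (by norm_num : (0 : ℝ) ≤ 1 / 2)
      (by norm_num)).mul_const ((1 - F t) * (y - t))
    simpa using this.const_add (2 * (v t * (1 - F t)))
  exact ge_of_tendsto hlim (.of_forall fun N => key N t ht htδ y hty)

lemma IsTwoSidedAuxiliary.integrableOn_tail {F v : ℝ → ℝ} (hF : IsDF F) (hc : Continuous F)
    (hv : IsTwoSidedAuxiliary F v) (t : ℝ) : IntegrableOn (fun s => 1 - F s) (Ioi t) := by
  by_cases hend : ∃ x, 1 - F x = 0
  · obtain ⟨x, hx⟩ := hend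
    have h1 : IntegrableOn (fun s => 1 - F s) (Ioc t x) :=
      ((continuous_const.sub hc).integrableOn_Icc (a := t) (b := x)).mono_set Ioc_subset_Icc_self
    have h2 : IntegrableOn (fun s => 1 - F s) (Ioi x) := by
      refine integrableOn_zero.congr_fun (fun s (hs : x < s) => ?_) measurableSet_Ioi
      have := hF.mono hs.le
      have := hF.le_one s
      change 0 = 1 - F s
      linarith
    exact (h1.union h2).mono_set fun s hs => (le_or_gt s x).imp (fun h => ⟨hs, h⟩) id
  · push Not at hend
    obtain ⟨δ, hδ, hb⟩ := hv.integral_tail_le hF hc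
    have hTt : Tendsto (fun x => 1 - F x) atTop (𝓝 0) := by
      simpa using hF.tendsto_atTop.const_sub 1
    obtain ⟨x, hx⟩ := (hTt.eventually_lt_const hδ).exists
    have hx0 : 0 < 1 - F x := (sub_nonneg.2 (hF.le_one x)).lt_of_ne' (hend x)
    have h1 : IntegrableOn (fun s => 1 - F s) (Ioc t x) :=
      ((continuous_const.sub hc).integrableOn_Icc (a := t) (b := x)).mono_set Ioc_subset_Icc_self
    have h2 : IntegrableOn (fun s => 1 - F s) (Ioi x) := by
      refine integrableOn_Ioi_of_intervalIntegral_norm_bounded (l := atTop) (b := id)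
        (2 * (v x * (1 - F x))) x (fun y => ?_) tendsto_id ?_
      · exact ((continuous_const.sub hc).integrableOn_Icc (a := x) (b := y)).mono_set
          Ioc_subset_Icc_self
      · filter_upwards [eventually_ge_atTop x] with y hy
        simpa only [Real.norm_of_nonneg (sub_nonneg.2 (hF.le_one _)), id] using hb x hx0 hx y hy
    exact (h1.union h2).mono_set fun s hs => (le_or_gt s x).imp (fun h => ⟨hs, h⟩) id

/-- On `[t, t + M v t]` dominated convergence gives the proportion `1 - e^{-M}`, and the integral
over the rest is of the order `e^{-M} v t (1 - F t)`. -/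
lemma IsTwoSidedAuxiliary.tendsto_meanResidualLife_div {F v : ℝ → ℝ} (hF : IsDF F)
    (hc : Continuous F) (hv : IsTwoSidedAuxiliary F v) :
    Tendsto (fun t => meanResidualLife F t / v t) (toRightEnd F) (𝓝 1) := by
  have hT := tendsto_tail_toRightEnd hF hc
  have hpos : ∀ᶠ t in toRightEnd F, 0 < 1 - F t := hT.eventually self_mem_nhdsWithin
  have hint := hv.integrableOn_tail hF hc
  have hnn : ∀ s, 0 ≤ 1 - F s := fun s => sub_nonneg.2 (hF.le_one s)
  obtain ⟨δ, hδ, hb⟩ := hv.integral_tail_le hF hc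
  have hJ : ∀ᶠ t in toRightEnd F, ∫ s in Ioi t, (1 - F s) ≤ 2 * (v t * (1 - F t)) := by
    filter_upwards [hpos, (tendsto_nhds_of_tendsto_nhdsWithin hT).eventually_lt_const hδ]
      with t h1 h2
    refine le_of_tendsto (intervalIntegral_tendsto_integral_Ioi t (hint t) tendsto_id) ?_
    filter_upwards [eventually_ge_atTop t] with y hy using hb t h1 h2 y hy
  have hcount : (toRightEnd F).IsCountablyGenerated := by unfold toRightEnd; infer_instance
  have hmain : ∀ M : ℝ, 0 ≤ M → Tendsto
      (fun t => ∫ x in (0 : ℝ)..M, (1 - F (t + v t * x)) / (1 - F t)) (toRightEnd F)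
      (𝓝 (1 - Real.exp (-M))) := by
    intro M hM
    have hval : ∫ x in (0 : ℝ)..M, Real.exp (-x) = 1 - Real.exp (-M) := by
      rw [intervalIntegral.integral_comp_neg (fun x => Real.exp x), integral_exp]
      simp
    rw [← hval]
    refine intervalIntegral.tendsto_integral_filter_of_dominated_convergence (fun _ => 1) ?_ ?_
      intervalIntegrable_const ?_
    · refine .of_forall fun t => Continuous.aestronglyMeasurable ?_
      fun_prop
    · filter_upwards [hpos] with t ht
      refine ae_of_all _ fun x hx => ?_
      rw [uIoc_of_le hM] at hx
      rw [Real.norm_of_nonneg (div_nonneg (hnn _) ht.le), div_le_one ht]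
      exact hF.antitone_tail (by nlinarith [hv.pos t, hx.1])
    · exact ae_of_all _ fun x _ => hv.tendsto x
  have hsplit : ∀ M : ℝ, 0 ≤ M → ∀ᶠ t in toRightEnd F, meanResidualLife F t / v t =
      (∫ x in (0 : ℝ)..M, (1 - F (t + v t * x)) / (1 - F t)) +
        (∫ s in Ioi (t + v t * M), (1 - F s)) / (v t * (1 - F t)) := by
    intro M hM
    filter_upwards [hpos] with t ht
    have hvt := hv.pos t
    have h1 : ∫ x in (0 : ℝ)..M, (1 - F (t + v t * x)) / (1 - F t) =
        (∫ s in t..(t + v t * M), (1 - F s)) / (v t * (1 - F t)) := by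
      rw [intervalIntegral.integral_div,
        intervalIntegral.integral_comp_add_mul (fun s => 1 - F s) hvt.ne' t, mul_zero, add_zero,
        smul_eq_mul]
      field_simp
    have h2 : ∫ s in Ioi t, (1 - F s) = (∫ s in t..(t + v t * M), (1 - F s)) +
        ∫ s in Ioi (t + v t * M), (1 - F s) :=
      (intervalIntegral.integral_interval_add_Ioi (hint t) (hint _)).symm
    rw [h1, ← add_div, ← h2, meanResidualLife, div_div, mul_comm (v t)]
  have htail : ∀ M : ℝ, ∀ᶠ t in toRightEnd F,
      (∫ s in Ioi (t + v t * M), (1 - F s)) / (v t * (1 - F t)) < 3 * Real.exp (-M) := by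
    intro M
    obtain ⟨hsh, hvv⟩ := hv.tendsto_shift hF hc M
    have h1 := (hvv.mul (hv.tendsto M)).const_mul 2
    rw [one_mul] at h1
    have he := Real.exp_pos (-M)
    filter_upwards [hpos, hsh.eventually hJ, h1.eventually_lt_const
      (show _ < 3 * Real.exp (-M) by linarith)] with t ht h2 h3
    refine lt_of_le_of_lt ?_ h3
    have hvt := hv.pos t
    rw [div_mul_div_comm, ← mul_div_assoc]
    gcongr
  rw [tendsto_order]
  have hexp : Tendsto (fun M : ℝ => 3 * Real.exp (-M)) atTop (𝓝 0) := by
    simpa using (Real.tendsto_exp_neg_atTop_nhds_zero).const_mul 3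
  refine ⟨fun c hc1 => ?_, fun c hc1 => ?_⟩
  · obtain ⟨M, hM0, hM⟩ := ((eventually_ge_atTop (0 : ℝ)).and
      (hexp.eventually_lt_const (sub_pos.2 hc1))).exists
    have he := Real.exp_pos (-M)
    filter_upwards [hpos, hsplit M hM0, (hmain M hM0).eventually_const_lt
      (by linarith : c < 1 - Real.exp (-M))] with t ht h1 h2
    have h3 : 0 ≤ (∫ s in Ioi (t + v t * M), (1 - F s)) / (v t * (1 - F t)) :=
      div_nonneg (integral_nonneg hnn) (mul_nonneg (hv.pos t).le ht.le)
    linarith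
  · obtain ⟨M, hM0, hM⟩ := ((eventually_ge_atTop (0 : ℝ)).and
      (hexp.eventually_lt_const (sub_pos.2 hc1))).exists
    have he := Real.exp_pos (-M)
    filter_upwards [hsplit M hM0, htail M, (hmain M hM0).eventually_lt_const
      (by linarith : 1 - Real.exp (-M) < 1)] with t h1 h2 h3
    linarith

lemma IsTwoSidedAuxiliary.isAuxiliary_meanResidualLife {F v : ℝ → ℝ} (hF : IsDF F)
    (hc : Continuous F) (hv : IsTwoSidedAuxiliary F v) : IsAuxiliary F (meanResidualLife F) := by
  refine ⟨fun t ht => ?_, fun x _ =>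
    hv.tendsto_of_tendsto_div hF (hv.tendsto_meanResidualLife_div hF hc) x⟩
  obtain ⟨y, hty, hy⟩ := EReal.lt_iff_exists_real_btwn.1 ht
  rw [EReal.coe_lt_coe_iff] at hty
  rw [lt_rightEnd_iff hF hc] at ht hy
  refine div_pos ?_ (sub_pos.2 ht)
  have h1 : 0 < ∫ s in t..y, (1 - F s) :=
    intervalIntegral.intervalIntegral_pos_of_pos_on
      ((continuous_const.sub hc).intervalIntegrable t y)
      (fun s hs => by linarith [hF.mono hs.2.le]) hty
  refine h1.trans_le ?_
  rw [intervalIntegral.integral_of_le hty.le]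
  exact setIntegral_mono_set (hv.integrableOn_tail hF hc t)
    (ae_of_all _ fun s => sub_nonneg.2 (hF.le_one s)) Ioc_subset_Ioi_self.eventuallyLE

end UpperOrder

theorem mainTheorem1 (F f : ℝ → ℝ) (hF : UpperOrder.IsDF F) (hf : UpperOrder.IsPdf F f)
    (k : ℕ) (hk : 1 ≤ k) :
    -- (a)
    (UpperOrder.IsDF (UpperOrder.upperDF F k) ∧
      UpperOrder.rightEnd (UpperOrder.upperDF F k) = UpperOrder.rightEnd F ∧
      UpperOrder.IsPdf (UpperOrder.upperDF F k) (UpperOrder.upperPdf F f k) ∧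
      Tendsto (fun x => (1 - UpperOrder.upperDF F k x) / (1 - F x) ^ k)
        (UpperOrder.toRightEnd F) (𝓝 (1 / (k.factorial : ℝ))) ∧
      UpperOrder.TailEquivalent (UpperOrder.upperDF F k) (UpperOrder.powerTailDF F k)) ∧
    -- (b)
    (∀ α : ℝ, 0 < α → UpperOrder.InMaxDomain F (UpperOrder.frechet α) →
      UpperOrder.rightEnd (UpperOrder.upperDF F k) = UpperOrder.rightEnd F ∧
      UpperOrder.rightEnd F = ⊤ ∧
      UpperOrder.InMaxDomain (UpperOrder.upperDF F k) (UpperOrder.frechet (k * α)) ∧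
      UpperOrder.MaxConverges (UpperOrder.upperDF F k) (UpperOrder.frechet (k * α))
        (fun n => UpperOrder.quantile F (1 - ((k.factorial : ℝ) / (n : ℝ)) ^ (1 / (k : ℝ))))
        (fun _ => 0)) ∧
    -- (c)
    (∀ α : ℝ, 0 < α → UpperOrder.InMaxDomain F (UpperOrder.weibull α) →
      UpperOrder.rightEnd (UpperOrder.upperDF F k) = UpperOrder.rightEnd F ∧
      UpperOrder.rightEnd F < ⊤ ∧
      UpperOrder.InMaxDomain (UpperOrder.upperDF F k) (UpperOrder.weibull (k * α)) ∧
      UpperOrder.MaxConverges (UpperOrder.upperDF F k) (UpperOrder.weibull (k * α))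
        (fun n => (UpperOrder.rightEnd F).toReal -
          UpperOrder.quantile F (1 - ((k.factorial : ℝ) / (n : ℝ)) ^ (1 / (k : ℝ))))
        (fun _ => (UpperOrder.rightEnd F).toReal)) ∧
    -- (d)
    (UpperOrder.InMaxDomain F UpperOrder.gumbel →
      UpperOrder.rightEnd (UpperOrder.upperDF F k) = UpperOrder.rightEnd F ∧
      UpperOrder.InMaxDomain (UpperOrder.upperDF F k) UpperOrder.gumbel ∧
      (∀ v : ℝ → ℝ, UpperOrder.IsAuxiliary F v →
        UpperOrder.MaxConverges (UpperOrder.upperDF F k) UpperOrder.gumbel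
          (fun n => v (UpperOrder.quantile (UpperOrder.upperDF F k) (1 - 1 / (n : ℝ))) / (k : ℝ))
          (fun n => UpperOrder.quantile (UpperOrder.upperDF F k) (1 - 1 / (n : ℝ)))) ∧
      (∀ t : ℝ, IntegrableOn (fun s => 1 - F s) (Ioi t)) ∧
      UpperOrder.IsAuxiliary F (UpperOrder.meanResidualLife F)) := by
  have hc := hf.continuous
  have hr := UpperOrder.rightEnd_upperDF hF hk
  have hpdf := UpperOrder.isPdf_upperDF hF hf hk
  refine ⟨⟨UpperOrder.isDF_upperDF hF hc hk, hr, hpdf,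
    UpperOrder.tendsto_tail_upperDF_ratio hF hc k, UpperOrder.tailEquivalent_upperDF hF hc hk⟩,
    fun α hα h => ?_, fun α hα h => ?_, fun h => ?_⟩
  · obtain ⟨h1, h2⟩ := UpperOrder.frechet_domain hF hc hk hα h
    exact ⟨hr, h1, h2.inMaxDomain, h2⟩
  · obtain ⟨h1, h2⟩ := UpperOrder.weibull_domain hF hc hk hα h
    exact ⟨hr, h1, h2.inMaxDomain, h2⟩
  · obtain ⟨v, hv⟩ := UpperOrder.exists_isTwoSidedAuxiliary hF hc h
    have hmax := fun w => UpperOrder.maxConverges_gumbel_of_isAuxiliary (v := w) hF hc hk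
      hpdf.continuous h
    have hm := hv.isAuxiliary_meanResidualLife hF hc
    exact ⟨hr, (hmax _ hm).inMaxDomain, hmax, hv.integrableOn_tail hF hc, hm⟩
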